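/- Let $\mathcal K_1(\mathbb R^n)$ be the space of all $\varphi\in C^\infty(\mathbb R^n)$ for which the norms $\nu_k(\varphi)=\sup_{t\in\mathbb R^n,\,|\alpha|\le k}e^{k|t|}|\varphi^{(\alpha)}(t)|$, $k\in\mathbb N_0$, are all finite, with the topology defined by these norms, and let $\mathcal K_1'(\mathbb R^n)$ be its dual, with the strong topology. For $\psi\in\mathcal K_1(\mathbb R^n)$ and $f\in\mathcal K_1'(\mathbb R^n)$ the short-time Fourier transform of $f$ with window $\psi$ is $$V_\psi f(x,z)=\big\langle f(t),\,e^{-2\pi i z\cdot t}\,\overline{\psi(t-x)}\big\rangle_t,\qquad x\in\mathbb R^n,\ z\in\mathbb C^n .$$ For $\lambda\ge 0$ let $\Pi_\lambda=\mathbb R^n+i[-\lambda,\lambda]^n\subset\mathbb C^n$. Let $B'\subset\mathcal K_1'(\mathbb R^n)$ and $\psi\in\mathcal K_1(\mathbb R^n)\setminus\{0\}$. If there are $\eta\in\mathbb R^n$ and $k\in\mathbb N_0$ such that $$\sup_{f\in B',\ (x,\xi)\in\mathbb R^{2n}}e^{-k|x|}(1+|\xi|)^{-k}|V_\psi f(x,\xi+i\eta)|<\infty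 ,$$ then $B'$ is bounded in $\mathcal K_1'(\mathbb R^n)$. Conversely, if $B'$ is bounded in $\mathcal K_1'(\mathbb R^n)$, then there is $k\in\mathbb N_0$ such that, for every $\lambda\ge 0$, $$\sup_{f\in B',\ (x,z)\in\mathbb R^n\times\Pi_\lambda}e^{-k|x|-2\pi x\cdot\operatorname{Im}z}(1+|z|)^{-k}|V_\psi f(x,z)|<\infty .$$ -/

import Mathlib

open scoped ContDiff

noncomputable section

namespace ExpType

/-- The partial derivative `∂_{j 0} ⋯ ∂_{j (m - 1)} φ` at `t`. When `φ` is smooth this is `φ^(α)(t)`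
for the multi-index `α` (of length `|α| = m`) that counts how often each coordinate occurs in `j`,
and each multi-index of length `m` arises from some `j`. -/
def partialDeriv {n m : ℕ} (j : Fin m → Fin n) (φ : EuclideanSpace ℝ (Fin n) → ℂ)
    (t : EuclideanSpace ℝ (Fin n)) : ℂ :=
  iteratedFDeriv ℝ m φ t (fun i => EuclideanSpace.single (j i) (1 : ℝ))

/-- Pairs of a point `t` and a partial derivative of order at most `k`. -/
abbrev NuIndex (n k : ℕ) : Type :=
  EuclideanSpace ℝ (Fin n) × (Σ m : Fin (k + 1), (Fin m → Fin n))

/-- The quantity `e^{k|t|} |φ^(α)(t)|`, whose supremum over `t` and `|α| ≤ k` is `ν_k(φ)`. -/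
def nuTerm {n : ℕ} (k : ℕ) (φ : EuclideanSpace ℝ (Fin n) → ℂ) (p : NuIndex n k) : ℝ :=
  Real.exp (k * ‖p.1‖) * ‖partialDeriv p.2.2 φ p.1‖

/-- Membership in the Hasumi-Silva space: `φ` is smooth and every `ν_k(φ)` is finite. -/
def IsKOne {n : ℕ} (φ : EuclideanSpace ℝ (Fin n) → ℂ) : Prop :=
  ContDiff ℝ ∞ φ ∧ ∀ k : ℕ, BddAbove (Set.range (nuTerm k φ))

lemma nuTerm_nonneg {n k : ℕ} (φ : EuclideanSpace ℝ (Fin n) → ℂ) (p : NuIndex n k) :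
    0 ≤ nuTerm k φ p := by
  unfold nuTerm; positivity

lemma nuTerm_add_le {n k : ℕ} {φ χ : EuclideanSpace ℝ (Fin n) → ℂ} (hφ : ContDiff ℝ ∞ φ)
    (hχ : ContDiff ℝ ∞ χ) (p : NuIndex n k) :
    nuTerm k (φ + χ) p ≤ nuTerm k φ p + nuTerm k χ p := by
  have h : partialDeriv p.2.2 (φ + χ) p.1
      = partialDeriv p.2.2 φ p.1 + partialDeriv p.2.2 χ p.1 := by
    unfold partialDeriv
    rw [iteratedFDeriv_add_apply (hφ.contDiffAt.of_le (by exact_mod_cast le_top))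
      (hχ.contDiffAt.of_le (by exact_mod_cast le_top))]
    rfl
  unfold nuTerm
  rw [h, ← mul_add]
  gcongr
  exact norm_add_le _ _

lemma nuTerm_smul {n k : ℕ} {φ : EuclideanSpace ℝ (Fin n) → ℂ} (hφ : ContDiff ℝ ∞ φ) (c : ℂ)
    (p : NuIndex n k) : nuTerm k (c • φ) p = ‖c‖ * nuTerm k φ p := by
  have h : partialDeriv p.2.2 (c • φ) p.1 = c * partialDeriv p.2.2 φ p.1 := by
    unfold partialDeriv
    rw [iteratedFDeriv_const_smul_apply (hφ.contDiffAt.of_le (by exact_mod_cast le_top))]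
    rfl
  unfold nuTerm
  rw [h, norm_mul]
  ring

/-- The Hasumi-Silva space as a subspace of the space of all functions. -/
def kOneSubmodule (n : ℕ) : Submodule ℂ (EuclideanSpace ℝ (Fin n) → ℂ) where
  carrier := {φ | IsKOne φ}
  zero_mem' := by
    have h0 : ContDiff ℝ ∞ (0 : EuclideanSpace ℝ (Fin n) → ℂ) := contDiff_const
    refine ⟨h0, fun k => ⟨0, ?_⟩⟩
    rintro _ ⟨p, rfl⟩
    have h := nuTerm_smul h0 0 p
    simp only [zero_smul, norm_zero, zero_mul] at h
    exact h.le
  add_mem' := by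
    rintro φ χ ⟨hφ, hφ'⟩ ⟨hχ, hχ'⟩
    refine ⟨hφ.add hχ, fun k => ?_⟩
    obtain ⟨a, ha⟩ := hφ' k
    obtain ⟨b, hb⟩ := hχ' k
    refine ⟨a + b, ?_⟩
    rintro _ ⟨p, rfl⟩
    exact (nuTerm_add_le hφ hχ p).trans (add_le_add (ha ⟨p, rfl⟩) (hb ⟨p, rfl⟩))
  smul_mem' := by
    rintro c φ ⟨hφ, hφ'⟩
    refine ⟨hφ.const_smul c, fun k => ?_⟩
    obtain ⟨a, ha⟩ := hφ' k
    refine ⟨‖c‖ * a, ?_⟩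
    rintro _ ⟨p, rfl⟩
    rw [nuTerm_smul hφ]
    exact mul_le_mul_of_nonneg_left (ha ⟨p, rfl⟩) (norm_nonneg c)

/-- The Hasumi-Silva space `K₁(ℝⁿ)` of exponentially rapidly decreasing smooth functions. It is a
type of its own, so that it carries the topology given below and not that of pointwise
convergence. -/
def KOne (n : ℕ) : Type := ↥(kOneSubmodule n)

instance (n : ℕ) : AddCommGroup (KOne n) := inferInstanceAs (AddCommGroup ↥(kOneSubmodule n))

instance (n : ℕ) : Module ℂ (KOne n) := inferInstanceAs (Module ℂ ↥(kOneSubmodule n))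

instance (n : ℕ) : CoeFun (KOne n) (fun _ => EuclideanSpace ℝ (Fin n) → ℂ) := ⟨Subtype.val⟩

/-- The norm `ν_k(φ) = sup_{t, |α| ≤ k} e^{k|t|} |φ^(α)(t)|` on `K₁(ℝⁿ)`. -/
def nu (n k : ℕ) : Seminorm ℂ (KOne n) :=
  Seminorm.of (fun φ : KOne n => ⨆ p : NuIndex n k, nuTerm k φ p)
    (fun φ χ => by
      have : Nonempty (NuIndex n k) := ⟨(0, ⟨0, Fin.elim0⟩)⟩
      refine ciSup_le fun p => (nuTerm_add_le φ.2.1 χ.2.1 p).trans ?_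
      exact add_le_add (le_ciSup (φ.2.2 k) p) (le_ciSup (χ.2.2 k) p))
    (fun c φ => by
      rw [Real.mul_iSup_of_nonneg (norm_nonneg c)]
      exact congrArg iSup (funext fun p => nuTerm_smul φ.2.1 c p))

/-- The topology of `K₁(ℝⁿ)` is generated by the norms `ν_k`. -/
instance (n : ℕ) : TopologicalSpace (KOne n) :=
  (SeminormFamily.moduleFilterBasis (𝕜 := ℂ) (nu n)).topology

lemma withSeminorms_nu (n : ℕ) : WithSeminorms (𝕜 := ℂ) (nu n) := ⟨rfl⟩

instance (n : ℕ) : IsTopologicalAddGroup (KOne n) := (withSeminorms_nu n).topologicalAddGroup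

instance (n : ℕ) : ContinuousSMul ℂ (KOne n) := (withSeminorms_nu n).continuousSMul

/-- The space `K₁'(ℝⁿ)` of distributions of exponential type: the continuous linear functionals on
`K₁(ℝⁿ)`, with the strong dual topology (uniform convergence on bounded sets). -/
abbrev KOneDual (n : ℕ) : Type := StrongDual ℂ (KOne n)

lemma isKOne_of_iteratedFDeriv {n : ℕ} {φ : EuclideanSpace ℝ (Fin n) → ℂ} (hφ : ContDiff ℝ ∞ φ)
    (h : ∀ k m : ℕ, ∃ C : ℝ, ∀ t, Real.exp (k * ‖t‖) * ‖iteratedFDeriv ℝ m φ t‖ ≤ C) :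
    IsKOne φ := by
  refine ⟨hφ, fun k => ?_⟩
  choose C hC using h k
  refine ⟨∑ m : Fin (k + 1), |C m|, ?_⟩
  rintro _ ⟨⟨t, m, j⟩, rfl⟩
  have h1 : ‖partialDeriv j φ t‖ ≤ ‖iteratedFDeriv ℝ m φ t‖ := by
    refine (ContinuousMultilinearMap.le_opNorm _ _).trans ?_
    simp
  calc nuTerm k φ (t, ⟨m, j⟩) ≤ Real.exp (k * ‖t‖) * ‖iteratedFDeriv ℝ m φ t‖ := by
        unfold nuTerm; gcongr
    _ ≤ |C m| := (hC m t).trans (le_abs_self _)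
    _ ≤ ∑ m : Fin (k + 1), |C m| :=
        Finset.single_le_sum (f := fun m : Fin (k + 1) => |C m|)
          (fun i _ => abs_nonneg _) (Finset.mem_univ m)

lemma norm_iteratedFDeriv_le_sum {n : ℕ} (m : ℕ) (φ : EuclideanSpace ℝ (Fin n) → ℂ)
    (t : EuclideanSpace ℝ (Fin n)) :
    ‖iteratedFDeriv ℝ m φ t‖ ≤ ∑ j : Fin m → Fin n, ‖partialDeriv j φ t‖ := by
  refine ContinuousMultilinearMap.opNorm_le_bound (by positivity) fun v => ?_
  have hv : v = fun i => ∑ l : Fin n, v i l • EuclideanSpace.single l (1 : ℝ) := by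
    funext i
    ext a
    simp [Pi.single_apply]
  have h2 : iteratedFDeriv ℝ m φ t v
      = ∑ j : Fin m → Fin n, (∏ i, v i (j i)) • partialDeriv j φ t := by
    conv_lhs => rw [hv]
    rw [ContinuousMultilinearMap.map_sum]
    refine Finset.sum_congr rfl fun j _ => ?_
    rw [ContinuousMultilinearMap.map_smul_univ]
    rfl
  rw [h2, Finset.sum_mul]
  refine (norm_sum_le _ _).trans (Finset.sum_le_sum fun j _ => ?_)
  rw [norm_smul, mul_comm, norm_prod]
  gcongr with i
  exact PiLp.norm_apply_le (v i) (j i)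

lemma IsKOne.iteratedFDeriv_bound {n : ℕ} {φ : EuclideanSpace ℝ (Fin n) → ℂ} (hφ : IsKOne φ)
    (k m : ℕ) : ∃ C : ℝ, ∀ t, Real.exp (k * ‖t‖) * ‖iteratedFDeriv ℝ m φ t‖ ≤ C := by
  obtain ⟨A, hA⟩ := hφ.2 (max k m)
  refine ⟨∑ _j : Fin m → Fin n, A, fun t => ?_⟩
  refine (mul_le_mul_of_nonneg_left (norm_iteratedFDeriv_le_sum m φ t)
    (Real.exp_pos _).le).trans ?_
  rw [Finset.mul_sum]
  refine Finset.sum_le_sum fun j _ => ?_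
  refine le_trans ?_ (hA ⟨(t, ⟨⟨m, by omega⟩, j⟩), rfl⟩)
  unfold nuTerm
  gcongr
  exact le_max_left _ _

lemma norm_iteratedFDeriv_exp_le {n : ℕ} (L : EuclideanSpace ℝ (Fin n) →L[ℝ] ℂ) (m : ℕ)
    (t : EuclideanSpace ℝ (Fin n)) :
    ‖iteratedFDeriv ℝ m (fun s => Complex.exp (L s)) t‖ ≤ ‖L‖ ^ m * Real.exp (‖L‖ * ‖t‖) := by
  have hs : ContDiff ℝ ∞ (fun s => Complex.exp (L s)) := L.contDiff.cexp
  induction m with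
  | zero =>
    rw [norm_iteratedFDeriv_zero, pow_zero, one_mul, Complex.norm_exp]
    exact Real.exp_le_exp.2 (((le_abs_self _).trans (Complex.abs_re_le_norm _)).trans
      (L.le_opNorm t))
  | succ m ih =>
    have h2 : fderiv ℝ (fun s => Complex.exp (L s))
        = ((ContinuousLinearMap.lsmul ℝ ℂ :
            ℂ →L[ℝ] (EuclideanSpace ℝ (Fin n) →L[ℝ] ℂ) →L[ℝ] _).flip L) ∘
          fun s => Complex.exp (L s) := by
      funext s
      have := (L.hasFDerivAt (x := s)).cexp.fderiv
      simp [this]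
    have h3 : ‖(ContinuousLinearMap.lsmul ℝ ℂ :
            ℂ →L[ℝ] (EuclideanSpace ℝ (Fin n) →L[ℝ] ℂ) →L[ℝ] _).flip L‖ ≤ ‖L‖ := by
      refine ContinuousLinearMap.opNorm_le_bound _ (norm_nonneg L) fun c => ?_
      simp [norm_smul, mul_comm]
    rw [← norm_iteratedFDeriv_fderiv, h2]
    refine (ContinuousLinearMap.norm_iteratedFDeriv_comp_left _
      (hs.contDiffAt (x := t)) (n := m) (by exact_mod_cast le_top)).trans ?_
    rw [pow_succ', mul_assoc]
    exact mul_le_mul h3 ih (norm_nonneg _) (norm_nonneg _)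

/-- The function `t ↦ e^{-2πi z·t} conj (ψ (t - x))`, for `z ∈ ℂⁿ`. For real `z = ξ` it is the
complex conjugate of the time-frequency shift `M_ξ T_x ψ`. -/
def stftAtomFun {n : ℕ} (ψ : EuclideanSpace ℝ (Fin n) → ℂ) (x : EuclideanSpace ℝ (Fin n))
    (z : EuclideanSpace ℂ (Fin n)) (t : EuclideanSpace ℝ (Fin n)) : ℂ :=
  Complex.exp (-2 * Real.pi * Complex.I * ∑ j, z j * (t j : ℂ)) * starRingEnd ℂ (ψ (t - x))

lemma isKOne_stftAtomFun {n : ℕ} {ψ : EuclideanSpace ℝ (Fin n) → ℂ} (hψ : IsKOne ψ)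
    (x : EuclideanSpace ℝ (Fin n)) (z : EuclideanSpace ℂ (Fin n)) :
    IsKOne (stftAtomFun ψ x z) := by
  obtain ⟨L, hL⟩ : ∃ L : EuclideanSpace ℝ (Fin n) →L[ℝ] ℂ, ∀ t,
      L t = -2 * Real.pi * Complex.I * ∑ j, z j * (t j : ℂ) := by
    refine ⟨∑ j, (-2 * Real.pi * Complex.I * z j) •
      (Complex.ofRealCLM.comp (EuclideanSpace.proj j : EuclideanSpace ℝ (Fin n) →L[ℝ] ℝ)),
      fun t => ?_⟩
    simp [Finset.mul_sum, mul_assoc]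
  have hfun : stftAtomFun ψ x z = fun t => Complex.exp (L t) *
      (Complex.conjLIE ∘ fun s => ψ (s - x)) t := by
    funext t
    simp [stftAtomFun, hL]
  have hE : ContDiff ℝ ∞ (fun s => Complex.exp (L s)) := L.contDiff.cexp
  have hg : ContDiff ℝ ∞ (Complex.conjLIE ∘ fun s => ψ (s - x)) :=
    Complex.conjLIE.contDiff.comp (hψ.1.comp (contDiff_id.sub contDiff_const))
  rw [hfun]
  refine isKOne_of_iteratedFDeriv (hE.mul hg) fun k m => ?_
  obtain ⟨K, hK⟩ := exists_nat_ge ((k : ℝ) + ‖L‖)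
  choose C hC using hψ.iteratedFDeriv_bound K
  refine ⟨∑ i ∈ Finset.range (m + 1),
    (m.choose i : ℝ) * ‖L‖ ^ i * (Real.exp (K * ‖x‖) * C (m - i)), fun t => ?_⟩
  refine (mul_le_mul_of_nonneg_left (norm_iteratedFDeriv_mul_le hE hg t (n := m)
    (by exact_mod_cast le_top)) (Real.exp_pos _).le).trans ?_
  rw [Finset.mul_sum]
  refine Finset.sum_le_sum fun i _ => ?_
  rw [LinearIsometryEquiv.norm_iteratedFDeriv_comp_left, iteratedFDeriv_comp_sub]
  set D := ‖iteratedFDeriv ℝ (m - i) ψ (t - x)‖ with hD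
  have hexp : Real.exp (k * ‖t‖) * Real.exp (‖L‖ * ‖t‖)
      ≤ Real.exp (K * ‖x‖) * Real.exp (K * ‖t - x‖) := by
    rw [← Real.exp_add, ← Real.exp_add, Real.exp_le_exp, ← add_mul, ← mul_add]
    have ht : ‖t‖ ≤ ‖x‖ + ‖t - x‖ := by simpa using norm_add_le x (t - x)
    exact mul_le_mul hK ht (norm_nonneg _) (Nat.cast_nonneg K)
  calc Real.exp (k * ‖t‖) * ((m.choose i : ℝ) *
        ‖iteratedFDeriv ℝ i (fun s => Complex.exp (L s)) t‖ * D)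
      ≤ Real.exp (k * ‖t‖) * ((m.choose i : ℝ) * (‖L‖ ^ i * Real.exp (‖L‖ * ‖t‖)) * D) := by
        gcongr
        exact norm_iteratedFDeriv_exp_le L i t
    _ = (m.choose i : ℝ) * ‖L‖ ^ i *
        ((Real.exp (k * ‖t‖) * Real.exp (‖L‖ * ‖t‖)) * D) := by ring
    _ ≤ (m.choose i : ℝ) * ‖L‖ ^ i *
        ((Real.exp (K * ‖x‖) * Real.exp (K * ‖t - x‖)) * D) := by gcongr
    _ = (m.choose i : ℝ) * ‖L‖ ^ i *
        (Real.exp (K * ‖x‖) * (Real.exp (K * ‖t - x‖) * D)) := by ring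
    _ ≤ _ := by
        gcongr
        exact hC (m - i) (t - x)

/-- The function `t ↦ e^{-2πi z·t} conj (ψ (t - x))` as an element of `K₁(ℝⁿ)`. -/
def stftAtom {n : ℕ} (ψ : KOne n) (x : EuclideanSpace ℝ (Fin n))
    (z : EuclideanSpace ℂ (Fin n)) : KOne n :=
  ⟨stftAtomFun ψ x z, isKOne_stftAtomFun ψ.2 x z⟩

/-- The short-time Fourier transform `V_ψ f(x, z) = ⟨f(t), e^{-2πi z·t} conj (ψ (t - x))⟩` of
`f ∈ K₁'(ℝⁿ)` with window `ψ ∈ K₁(ℝⁿ)`, for `x ∈ ℝⁿ` and `z ∈ ℂⁿ`. -/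
def stft {n : ℕ} (ψ : KOne n) (f : KOneDual n) (x : EuclideanSpace ℝ (Fin n))
    (z : EuclideanSpace ℂ (Fin n)) : ℂ :=
  f (stftAtom ψ x z)

/-- The point `ξ + iη` of `ℂⁿ`. -/
def complexPoint {n : ℕ} (ξ η : EuclideanSpace ℝ (Fin n)) : EuclideanSpace ℂ (Fin n) :=
  WithLp.toLp 2 fun j => (ξ j : ℂ) + (η j : ℂ) * Complex.I

/-- The imaginary part of a point of `ℂⁿ`. -/
def imPart {n : ℕ} (z : EuclideanSpace ℂ (Fin n)) : EuclideanSpace ℝ (Fin n) :=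
  WithLp.toLp 2 fun j => (z j).im

/-- The tube `Π_r = ℝⁿ + i[-r, r]ⁿ`. -/
def tube (n : ℕ) (r : ℝ) : Set (EuclideanSpace ℂ (Fin n)) :=
  {z | ∀ j, (z j).im ∈ Set.Icc (-r) r}

end ExpType

end

noncomputable section

namespace ExpType

variable {n : ℕ}

open MeasureTheory Filter Topology
open scoped FourierTransform

/-! A set of functionals is bounded in `KOneDual n` exactly when one estimate |f φ| ≤ C ν_k(φ) holds
on all of it (`exists_bound_of_isVonNBounded`, `isVonNBounded_of_le_nu`), so both implications are
estimates of norms.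

If B is bounded, it suffices to estimate ν_k of the atom e^{-2πi z·t} conj ψ(t - x). Derivatives of
the exponential cost powers of 1 + |z|. The decay of ψ concentrates the atom at t = x, where the
weight is e^{k|x|} and the exponential has modulus e^{2π x·Im z} (`nu_stftAtom_le`).

Conversely, f φ is reconstructed from the slice Im z = η. Integrating φ(t)|ψ(t - x)|² over x gives
φ(t) times ∫|ψ|², which is nonzero. For fixed x, Fourier inversion of e^{-2πη·t}φ(t)ψ(t - x) writes
φ|ψ(· - x)|² as a superposition of atoms at ξ + iη (`integral_fourier_mul_stftAtom`). Its
coefficients decay faster than any power of ξ and any exponential in x, with constants controlled by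
some ν_K(φ). They absorb the assumed growth of the transform, so f is dominated uniformly on B.

Moving f under these integrals is the task of `dual_apply_eq_integral`. Since f is continuous for a
single ν_k, and ν_k is the norm induced by an embedding into ℓ^∞, Hahn–Banach extends f to a Banach
space, where the Bochner integral is available. -/

lemma nuTerm_le_nu {k : ℕ} (φ : KOne n) (p : NuIndex n k) : nuTerm k φ p ≤ nu n k φ :=
  le_ciSup (φ.2.2 k) p

lemma nu_le {k : ℕ} {φ : KOne n} {C : ℝ}
    (h : ∀ m ≤ k, ∀ t, Real.exp (k * ‖t‖) * ‖iteratedFDeriv ℝ m φ t‖ ≤ C) : nu n k φ ≤ C := by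
  have : Nonempty (NuIndex n k) := ⟨(0, ⟨0, Fin.elim0⟩)⟩
  refine ciSup_le fun p => le_trans ?_ (h p.2.1 (by omega) p.1)
  unfold nuTerm
  gcongr
  refine (ContinuousMultilinearMap.le_opNorm _ _).trans ?_
  simp

lemma nu_mono {k l : ℕ} (hkl : k ≤ l) (φ : KOne n) : nu n k φ ≤ nu n l φ := by
  have : Nonempty (NuIndex n k) := ⟨(0, ⟨0, Fin.elim0⟩)⟩
  refine ciSup_le fun p => le_trans ?_
    (nuTerm_le_nu φ (k := l) (p.1, ⟨⟨p.2.1, by omega⟩, p.2.2⟩))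
  unfold nuTerm
  gcongr

/-- There are n^m coordinate derivatives of order m. The base n + 1 is at least 1 even for n = 0, so
the power can be raised from m to k. -/
lemma norm_iteratedFDeriv_le_nu {m k : ℕ} (hm : m ≤ k) (φ : KOne n)
    (t : EuclideanSpace ℝ (Fin n)) :
    ‖iteratedFDeriv ℝ m φ t‖ ≤ (n + 1) ^ k * nu n k φ * Real.exp (-(k * ‖t‖)) := by
  have h1 : ∀ j : Fin m → Fin n,
      ‖partialDeriv j φ t‖ ≤ nu n k φ * Real.exp (-(k * ‖t‖)) := fun j => by
    have := nuTerm_le_nu φ (k := k) (t, ⟨⟨m, by omega⟩, j⟩)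
    rw [Real.exp_neg, ← div_eq_mul_inv, le_div_iff₀ (Real.exp_pos _), mul_comm]
    exact this
  refine (norm_iteratedFDeriv_le_sum m φ t).trans
    ((Finset.sum_le_sum fun j _ => h1 j).trans ?_)
  have h0 : 0 ≤ nu n k φ := apply_nonneg _ _
  have h2 : ((n : ℝ)) ^ m ≤ (n + 1) ^ k :=
    (pow_le_pow_left₀ (by positivity) (by linarith) m).trans
      (pow_le_pow_right₀ (by linarith [(Nat.cast_nonneg n : (0 : ℝ) ≤ n)]) hm)
  simp only [Finset.sum_const, Finset.card_univ, Fintype.card_pi, Fintype.card_fin,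
    Finset.prod_const, nsmul_eq_mul, Nat.cast_pow, mul_assoc]
  gcongr

/-! ### Boundedness in the dual as domination by one norm -/

/-- A continuous functional on `K₁(ℝⁿ)` is dominated by a multiple of a single `ν_k`. -/
lemma exists_dual_bound (f : KOneDual n) :
    ∃ (k : ℕ) (C : ℝ), 0 ≤ C ∧ ∀ φ, ‖f φ‖ ≤ C * nu n k φ := by
  obtain ⟨s, C, -, h⟩ := Seminorm.bound_of_continuous (withSeminorms_nu n)
    ((normSeminorm ℂ ℂ).comp f.toLinearMap) (continuous_norm.comp f.continuous)
  refine ⟨s.sup id, C, C.2, fun φ => (h φ).trans ?_⟩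
  change (C : ℝ) * (s.sup (nu n)) φ ≤ _
  gcongr
  exact Seminorm.finset_sup_apply_le (apply_nonneg _ _) fun i hi =>
    nu_mono (Finset.le_sup (f := id) hi) φ

/-- A subset of `K₁'(ℝⁿ)` that is uniformly dominated by some `ν_k` is bounded. -/
lemma isVonNBounded_of_le_nu {B : Set (KOneDual n)} {k : ℕ} {C : ℝ}
    (h : ∀ f ∈ B, ∀ φ, ‖f φ‖ ≤ C * nu n k φ) : Bornology.IsVonNBounded ℂ B := by
  rw [ContinuousLinearMap.isVonNBounded_iff]
  intro s hs
  obtain ⟨r, hr0, hr⟩ := ((withSeminorms_nu n).isVonNBounded_iff_seminorm_bounded).1 hs k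
  rw [NormedSpace.isVonNBounded_iff' ℂ]
  refine ⟨|C| * r, ?_⟩
  rintro _ ⟨f, hf, φ, hφ, rfl⟩
  refine (h f hf φ).trans ?_
  exact mul_le_mul (le_abs_self C) (hr φ hφ).le (apply_nonneg _ _) (abs_nonneg C)

/-- A bounded subset of `K₁'(ℝⁿ)` is equicontinuous. -/
lemma exists_bound_of_isVonNBounded {B : Set (KOneDual n)} (hB : Bornology.IsVonNBounded ℂ B) :
    ∃ (k : ℕ) (C : ℝ), 0 ≤ C ∧ ∀ f ∈ B, ∀ φ, ‖f φ‖ ≤ C * nu n k φ := by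
  -- Gliding hump: choose |f_j φ_j| > j ν_j(φ_j) and rescale φ_j so that |f_j| takes the value j
  -- there while ν_j ≤ 1. As ν_k ≤ ν_j for j ≥ k, the rescaled functions form a bounded set, on
  -- which B should be uniformly bounded. No barrelledness is needed.
  by_contra! hcon
  choose f hf φ hφ using fun j : ℕ => hcon j j (Nat.cast_nonneg j)
  have hpos : ∀ j, 0 < ‖f j (φ j)‖ := fun j =>
    (mul_nonneg (Nat.cast_nonneg j) (apply_nonneg _ _)).trans_lt (hφ j)
  let c : ℕ → ℂ := fun j => (((j : ℝ) / ‖f j (φ j)‖ : ℝ) : ℂ)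
  have hc : ∀ j, ‖c j‖ = j / ‖f j (φ j)‖ := fun j => by
    simp only [c, Complex.norm_real, Real.norm_eq_abs]
    exact abs_of_nonneg (by positivity)
  have hnu : ∀ j, nu n j (c j • φ j) ≤ 1 := fun j => by
    rw [map_smul_eq_mul, hc, div_mul_eq_mul_div, div_le_one (hpos j)]
    exact (hφ j).le
  have hS : Bornology.IsVonNBounded ℂ (Set.range fun j => c j • φ j) := by
    rw [(withSeminorms_nu n).isVonNBounded_iff_seminorm_bounded]
    intro k
    have hsum : 0 ≤ ∑ i ∈ Finset.range k, nu n k (c i • φ i) :=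
      Finset.sum_nonneg fun i _ => apply_nonneg _ _
    refine ⟨∑ i ∈ Finset.range k, nu n k (c i • φ i) + 2, by linarith, ?_⟩
    rintro _ ⟨j, rfl⟩
    rcases lt_or_ge j k with hj | hj
    · have := Finset.single_le_sum (f := fun i => nu n k (c i • φ i))
        (fun i _ => apply_nonneg _ _) (Finset.mem_range.2 hj)
      simp only at this ⊢
      linarith
    · have := (nu_mono hj (c j • φ j)).trans (hnu j)
      simp only at this ⊢
      linarith
  have := ContinuousLinearMap.isVonNBounded_iff.1 hB _ hS
  rw [NormedSpace.isVonNBounded_iff' ℂ] at this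
  obtain ⟨M, hM⟩ := this
  obtain ⟨j, hj⟩ := exists_nat_gt M
  have h := hM _ ⟨f j, hf j, _, ⟨j, rfl⟩, rfl⟩
  simp only [map_smul, smul_eq_mul, norm_mul, hc] at h
  rw [div_mul_cancel₀ _ (hpos j).ne'] at h
  linarith

/-! ### Products with translates and with exponentials -/

lemma norm_iteratedFDeriv_mul_le_two_pow {f g : EuclideanSpace ℝ (Fin n) → ℂ}
    (hf : ContDiff ℝ ∞ f) (hg : ContDiff ℝ ∞ g) {m : ℕ} {a b : ℝ}
    {t : EuclideanSpace ℝ (Fin n)} (hfa : ∀ i ≤ m, ‖iteratedFDeriv ℝ i f t‖ ≤ a)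
    (hgb : ∀ i ≤ m, ‖iteratedFDeriv ℝ i g t‖ ≤ b) :
    ‖iteratedFDeriv ℝ m (fun s => f s * g s) t‖ ≤ 2 ^ m * a * b := by
  have ha : 0 ≤ a := (norm_nonneg _).trans (hfa 0 (Nat.zero_le m))
  refine (norm_iteratedFDeriv_mul_le hf hg t (n := m) (by exact_mod_cast le_top)).trans ?_
  calc _ ≤ ∑ i ∈ Finset.range (m + 1), (m.choose i : ℝ) * a * b := by
        refine Finset.sum_le_sum fun i hi => ?_
        gcongr
        · exact hfa i (by simp at hi; omega)
        · exact hgb _ (Nat.sub_le _ _)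
    _ = 2 ^ m * a * b := by
        rw [← Finset.sum_mul, ← Finset.sum_mul, ← Nat.cast_sum, Nat.sum_range_choose]
        simp

/-- Both factors decay at rate k + l. The share k of φ cancels the weight e^{k|t|}; the two shares l
combine, through |x| ≤ |t| + |t - x|, into decay in x. -/
lemma norm_iteratedFDeriv_mul_translate_le (φ χ : KOne n) (x t : EuclideanSpace ℝ (Fin n))
    {m k l : ℕ} (hm : m ≤ k + l) :
    Real.exp (k * ‖t‖) * ‖iteratedFDeriv ℝ m (fun s => φ s * χ (s - x)) t‖ ≤
      2 ^ (k + l) * ((n + 1) ^ (k + l) * nu n (k + l) φ) * ((n + 1) ^ (k + l) * nu n (k + l) χ) *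
        Real.exp (-(l * ‖x‖)) := by
  have hχ : ContDiff ℝ ∞ (fun s => χ (s - x)) := χ.2.1.comp (contDiff_id.sub contDiff_const)
  have h := norm_iteratedFDeriv_mul_le_two_pow φ.2.1 hχ (m := m) (t := t)
    (a := (n + 1) ^ (k + l) * nu n (k + l) φ * Real.exp (-((k + l : ℕ) * ‖t‖)))
    (b := (n + 1) ^ (k + l) * nu n (k + l) χ * Real.exp (-((k + l : ℕ) * ‖t - x‖)))
    (fun i hi => norm_iteratedFDeriv_le_nu (hi.trans hm) φ t)
    (fun i hi => by
      rw [iteratedFDeriv_comp_sub]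
      exact norm_iteratedFDeriv_le_nu (hi.trans hm) χ (t - x))
  have h0 : 0 ≤ nu n (k + l) φ := apply_nonneg _ _
  have h1 : 0 ≤ nu n (k + l) χ := apply_nonneg _ _
  have h2 : (2 : ℝ) ^ m ≤ 2 ^ (k + l) := pow_le_pow_right₀ (by norm_num) hm
  have h3 : Real.exp (k * ‖t‖) * (Real.exp (-((k + l : ℕ) * ‖t‖)) *
      Real.exp (-((k + l : ℕ) * ‖t - x‖))) ≤ Real.exp (-(l * ‖x‖)) := by
    rw [← Real.exp_add, ← Real.exp_add, Real.exp_le_exp]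
    have hx : ‖x‖ ≤ ‖t‖ + ‖t - x‖ := by
      simpa using norm_sub_le t (t - x)
    have hk : (0 : ℝ) ≤ k * ‖t - x‖ := by positivity
    have hl : (l : ℝ) * ‖x‖ ≤ l * (‖t‖ + ‖t - x‖) := by gcongr
    push_cast
    linarith
  calc _ ≤ Real.exp (k * ‖t‖) * _ := mul_le_mul_of_nonneg_left h (Real.exp_pos _).le
    _ = 2 ^ m * ((n + 1) ^ (k + l) * nu n (k + l) φ) * ((n + 1) ^ (k + l) * nu n (k + l) χ) *
        (Real.exp (k * ‖t‖) * (Real.exp (-((k + l : ℕ) * ‖t‖)) *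
          Real.exp (-((k + l : ℕ) * ‖t - x‖)))) := by ring
    _ ≤ _ := by gcongr

/-- The function `t ↦ φ(t) χ(t - x)` as an element of `K₁(ℝⁿ)`. -/
def mulTranslate (φ χ : KOne n) (x : EuclideanSpace ℝ (Fin n)) : KOne n :=
  ⟨fun t => φ t * χ (t - x),
    isKOne_of_iteratedFDeriv (φ.2.1.mul (χ.2.1.comp (contDiff_id.sub contDiff_const)))
      -- Here l is taken to be m, which makes room for m derivatives.
      fun _ m => ⟨_, fun t => norm_iteratedFDeriv_mul_translate_le φ χ x t
        (Nat.le_add_left m _)⟩⟩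

@[simp]
lemma mulTranslate_apply (φ χ : KOne n) (x t : EuclideanSpace ℝ (Fin n)) :
    mulTranslate φ χ x t = φ t * χ (t - x) := rfl

lemma nu_mulTranslate_le (φ χ : KOne n) (x : EuclideanSpace ℝ (Fin n)) (k l : ℕ) :
    nu n k (mulTranslate φ χ x) ≤
      2 ^ (k + l) * ((n + 1) ^ (k + l) * nu n (k + l) φ) * ((n + 1) ^ (k + l) * nu n (k + l) χ) *
        Real.exp (-(l * ‖x‖)) :=
  nu_le fun _ hm t => norm_iteratedFDeriv_mul_translate_le φ χ x t (by omega)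

/-- Since e^{L s} = e^{L t} e^{L(s - t)}, the crude bound is only used at the origin. The
exponential factor then involves Re L alone: real frequencies cost only powers. -/
lemma norm_iteratedFDeriv_exp_le_re (L : EuclideanSpace ℝ (Fin n) →L[ℝ] ℂ) (m : ℕ)
    (t : EuclideanSpace ℝ (Fin n)) :
    ‖iteratedFDeriv ℝ m (fun s => Complex.exp (L s)) t‖ ≤ ‖L‖ ^ m * Real.exp (L t).re := by
  have h := norm_iteratedFDeriv_exp_le L m 0
  have h1 : (fun s => Complex.exp (L s)) =
      fun s => Complex.exp (L t) • (fun u => Complex.exp (L u)) (s - t) := by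
    funext s
    simp [← Complex.exp_add]
  have hs : ContDiff ℝ ∞ (fun s => Complex.exp (L (s - t))) :=
    (L.contDiff.comp (contDiff_id.sub contDiff_const)).cexp
  rw [h1, iteratedFDeriv_const_smul_apply' (hs.contDiffAt.of_le (by exact_mod_cast le_top)),
    norm_smul, Complex.norm_exp, iteratedFDeriv_comp_sub (f := fun u => Complex.exp (L u)),
    sub_self, mul_comm]
  gcongr
  simpa using h

/-- Moving the weight and Re L from t to x costs (k + a)|t - x| in the exponent, which the decay of
g around x, at rate K ≥ k + a, pays for. -/
lemma norm_iteratedFDeriv_exp_mul_translate_le (L : EuclideanSpace ℝ (Fin n) →L[ℝ] ℂ)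
    {g : EuclideanSpace ℝ (Fin n) → ℂ} (hg : ContDiff ℝ ∞ g) {k K : ℕ} {A : ℝ}
    {x : EuclideanSpace ℝ (Fin n)}
    (hgA : ∀ i ≤ K, ∀ t, ‖iteratedFDeriv ℝ i g t‖ ≤ A * Real.exp (-(K * ‖t - x‖)))
    {a : ℝ} (hL : ∀ t, (L t).re ≤ a * ‖t‖) (hK : k + a ≤ K) (hkK : k ≤ K) {m : ℕ} (hm : m ≤ k)
    (t : EuclideanSpace ℝ (Fin n)) :
    Real.exp (k * ‖t‖) * ‖iteratedFDeriv ℝ m (fun s => Complex.exp (L s) * g s) t‖ ≤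
      2 ^ k * (1 + ‖L‖) ^ k * A * Real.exp (k * ‖x‖ + (L x).re) := by
  have hA : 0 ≤ A := by
    have := (norm_nonneg _).trans (hgA 0 (Nat.zero_le _) t)
    exact nonneg_of_mul_nonneg_left this (Real.exp_pos _)
  have h := norm_iteratedFDeriv_mul_le_two_pow (f := fun s => Complex.exp (L s)) L.contDiff.cexp hg
    (m := m) (t := t) (a := (1 + ‖L‖) ^ k * Real.exp (L t).re)
    (b := A * Real.exp (-(K * ‖t - x‖)))
    (fun i hi => (norm_iteratedFDeriv_exp_le_re L i t).trans (by
      gcongr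
      exact (pow_le_pow_left₀ (norm_nonneg L) (by linarith) i).trans
        (pow_le_pow_right₀ (by linarith [norm_nonneg L]) (hi.trans hm))))
    (fun i hi => hgA i (by omega) t)
  have h2 : (2 : ℝ) ^ m ≤ 2 ^ k := pow_le_pow_right₀ (by norm_num) hm
  have h3 : Real.exp (k * ‖t‖) * (Real.exp (L t).re * Real.exp (-(K * ‖t - x‖))) ≤
      Real.exp (k * ‖x‖ + (L x).re) := by
    rw [← Real.exp_add, ← Real.exp_add, Real.exp_le_exp]
    have ht : ‖t‖ ≤ ‖x‖ + ‖t - x‖ := by simpa using norm_add_le x (t - x)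
    have e1 : (k : ℝ) * ‖t‖ ≤ k * (‖x‖ + ‖t - x‖) := by gcongr
    have e2 : (k + a) * ‖t - x‖ ≤ K * ‖t - x‖ := by gcongr
    have e3 := hL (t - x)
    rw [map_sub, Complex.sub_re] at e3
    linarith
  calc _ ≤ Real.exp (k * ‖t‖) * _ := mul_le_mul_of_nonneg_left h (Real.exp_pos _).le
    _ = 2 ^ m * (1 + ‖L‖) ^ k * A *
        (Real.exp (k * ‖t‖) * (Real.exp (L t).re * Real.exp (-(K * ‖t - x‖)))) := by ring
    _ ≤ _ := by gcongr

lemma re_apply_le_norm (L : EuclideanSpace ℝ (Fin n) →L[ℝ] ℂ) (t : EuclideanSpace ℝ (Fin n)) :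
    (L t).re ≤ ‖L‖ * ‖t‖ :=
  ((le_abs_self _).trans (Complex.abs_re_le_norm _)).trans (L.le_opNorm t)

lemma norm_iteratedFDeriv_exp_mul_le (L : EuclideanSpace ℝ (Fin n) →L[ℝ] ℂ) (φ : KOne n)
    {k K : ℕ} (hK : k + ‖L‖ ≤ K) {m : ℕ} (hm : m ≤ k) (t : EuclideanSpace ℝ (Fin n)) :
    Real.exp (k * ‖t‖) * ‖iteratedFDeriv ℝ m (fun s => Complex.exp (L s) * φ s) t‖ ≤
      2 ^ k * (1 + ‖L‖) ^ k * ((n + 1) ^ K * nu n K φ) := by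
  have hkK : k ≤ K := by exact_mod_cast (le_add_of_nonneg_right (norm_nonneg L)).trans hK
  have := norm_iteratedFDeriv_exp_mul_translate_le L φ.2.1 (k := k) (K := K) (x := 0)
    (A := (n + 1) ^ K * nu n K φ)
    (fun i hi t => by simpa using norm_iteratedFDeriv_le_nu hi φ t)
    (re_apply_le_norm L) hK hkK hm t
  simpa using this

/-- The function `t ↦ e^{L t} φ(t)` as an element of `K₁(ℝⁿ)`. -/
def expMul (L : EuclideanSpace ℝ (Fin n) →L[ℝ] ℂ) (φ : KOne n) : KOne n :=
  ⟨fun t => Complex.exp (L t) * φ t, by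
    refine isKOne_of_iteratedFDeriv (ContDiff.mul L.contDiff.cexp φ.2.1) fun k m => ?_
    -- The order m may exceed the weight k, so both are raised to their maximum.
    obtain ⟨K, hK⟩ := exists_nat_ge (((max k m : ℕ) : ℝ) + ‖L‖)
    refine ⟨_, fun t => le_trans ?_
      (norm_iteratedFDeriv_exp_mul_le L φ hK (le_max_right k m) t)⟩
    gcongr
    exact le_max_left _ _⟩

lemma nu_expMul_le (L : EuclideanSpace ℝ (Fin n) →L[ℝ] ℂ) (φ : KOne n) {k K : ℕ}
    (hK : k + ‖L‖ ≤ K) :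
    nu n k (expMul L φ) ≤ 2 ^ k * (1 + ‖L‖) ^ k * ((n + 1) ^ K * nu n K φ) :=
  nu_le fun _ hm t => norm_iteratedFDeriv_exp_mul_le L φ hK hm t

/-! ### Norms of the atoms and growth of the transform -/

/-- The linear form `t ↦ -2πi z·t`. -/
def phase (z : EuclideanSpace ℂ (Fin n)) : EuclideanSpace ℝ (Fin n) →L[ℝ] ℂ :=
  ∑ j, (-2 * Real.pi * Complex.I * z j) •
    (Complex.ofRealCLM.comp (EuclideanSpace.proj j : EuclideanSpace ℝ (Fin n) →L[ℝ] ℝ))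

lemma phase_apply (z : EuclideanSpace ℂ (Fin n)) (t : EuclideanSpace ℝ (Fin n)) :
    phase z t = -2 * Real.pi * Complex.I * ∑ j, z j * (t j : ℂ) := by
  simp [phase, Finset.mul_sum, mul_assoc]

lemma phase_re (z : EuclideanSpace ℂ (Fin n)) (t : EuclideanSpace ℝ (Fin n)) :
    (phase z t).re = 2 * Real.pi * inner ℝ t (imPart z) := by
  rw [phase_apply]
  simp [imPart, PiLp.inner_apply, Complex.mul_re]

lemma norm_phase_le (z : EuclideanSpace ℂ (Fin n)) : ‖phase z‖ ≤ 2 * Real.pi * ‖z‖ := by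
  refine ContinuousLinearMap.opNorm_le_bound _ (by positivity) fun t => ?_
  let w : EuclideanSpace ℂ (Fin n) := WithLp.toLp 2 fun j => (t j : ℂ)
  have hw : ‖w‖ = ‖t‖ := by simp [w, EuclideanSpace.norm_eq]
  let z' : EuclideanSpace ℂ (Fin n) := WithLp.toLp 2 fun j => starRingEnd ℂ (z j)
  have hz : ‖z'‖ = ‖z‖ := by simp [z', EuclideanSpace.norm_eq]
  have h : ∑ j, z j * (t j : ℂ) = inner ℂ z' w := by
    simp [PiLp.inner_apply, z', w, mul_comm]
  rw [phase_apply, h, norm_mul, ← hw, ← hz, mul_assoc (2 * Real.pi)]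
  have : ‖(-2 * Real.pi * Complex.I : ℂ)‖ = 2 * Real.pi := by
    simp [abs_of_pos Real.pi_pos]
  rw [this]
  gcongr
  exact norm_inner_le_norm _ _

lemma stftAtom_apply (ψ : KOne n) (x : EuclideanSpace ℝ (Fin n)) (z : EuclideanSpace ℂ (Fin n))
    (t : EuclideanSpace ℝ (Fin n)) :
    stftAtom ψ x z t = Complex.exp (phase z t) * starRingEnd ℂ (ψ (t - x)) := by
  rw [phase_apply]; rfl

lemma nu_stftAtom_le (ψ : KOne n) (x : EuclideanSpace ℝ (Fin n)) (z : EuclideanSpace ℂ (Fin n))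
    {k K : ℕ} (hK : k + 2 * Real.pi * ‖imPart z‖ ≤ K) :
    nu n k (stftAtom ψ x z) ≤ 2 ^ k * (1 + 2 * Real.pi * ‖z‖) ^ k * ((n + 1) ^ K * nu n K ψ) *
      Real.exp (k * ‖x‖ + 2 * Real.pi * inner ℝ x (imPart z)) := by
  have hkK : k ≤ K := by
    have : 0 ≤ 2 * Real.pi * ‖imPart z‖ := by positivity
    exact_mod_cast (le_add_of_nonneg_right this).trans hK
  have hg : ContDiff ℝ ∞ (Complex.conjLIE ∘ fun s => ψ (s - x)) :=
    Complex.conjLIE.contDiff.comp (ψ.2.1.comp (contDiff_id.sub contDiff_const))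
  have h0 : 0 ≤ nu n K ψ := apply_nonneg _ _
  refine nu_le fun m hm t => ?_
  have hfun : ⇑(stftAtom ψ x z) = fun s => Complex.exp (phase z s) *
      (Complex.conjLIE ∘ fun s => ψ (s - x)) s := by
    funext s
    rw [stftAtom_apply]; rfl
  rw [hfun]
  refine (norm_iteratedFDeriv_exp_mul_translate_le (phase z) hg (k := k) (K := K) (x := x)
    (A := (n + 1) ^ K * nu n K ψ) (fun i hi t => ?_) (a := 2 * Real.pi * ‖imPart z‖)
    (fun t => ?_) hK hkK hm t).trans ?_
  · rw [LinearIsometryEquiv.norm_iteratedFDeriv_comp_left, iteratedFDeriv_comp_sub]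
    exact norm_iteratedFDeriv_le_nu hi ψ (t - x)
  · rw [phase_re, mul_assoc (2 * Real.pi), mul_comm ‖imPart z‖]
    gcongr
    exact real_inner_le_norm _ _
  · rw [phase_re]
    gcongr
    exact norm_phase_le z

lemma norm_imPart_le_of_mem_tube {r : ℝ} {z : EuclideanSpace ℂ (Fin n)} (hz : z ∈ tube n r) :
    ‖imPart z‖ ≤ √(n * r ^ 2) := by
  rw [EuclideanSpace.norm_eq]
  refine Real.sqrt_le_sqrt ?_
  calc ∑ j, ‖imPart z j‖ ^ 2 ≤ ∑ _j : Fin n, r ^ 2 := by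
        refine Finset.sum_le_sum fun j _ => ?_
        rw [Real.norm_eq_abs, sq_abs]
        exact sq_le_sq' (hz j).1 (hz j).2
    _ = n * r ^ 2 := by simp

/-- The exponent k comes from the equicontinuity of B, before the tube is chosen. The width r enters
only through the order K of the norm of ψ and the constant. -/
lemma stft_bound_of_isVonNBounded (ψ : KOne n) {B : Set (KOneDual n)}
    (hB : Bornology.IsVonNBounded ℂ B) :
    ∃ k : ℕ, ∀ r : ℝ, 0 ≤ r → ∃ C : ℝ,
      ∀ f ∈ B, ∀ x : EuclideanSpace ℝ (Fin n), ∀ z ∈ tube n r,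
        Real.exp (-(k * ‖x‖) - 2 * Real.pi * inner ℝ x (imPart z)) * ((1 + ‖z‖) ^ k)⁻¹ *
          ‖stft ψ f x z‖ ≤ C := by
  obtain ⟨k, C, hC, h⟩ := exists_bound_of_isVonNBounded hB
  refine ⟨k, fun r _ => ?_⟩
  obtain ⟨K, hK⟩ := exists_nat_ge (k + 2 * Real.pi * √(n * r ^ 2))
  refine ⟨C * (2 ^ k * (2 * Real.pi) ^ k * ((n + 1) ^ K * nu n K ψ)), fun f hf x z hz => ?_⟩
  have h1 : k + 2 * Real.pi * ‖imPart z‖ ≤ K := le_trans (by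
    gcongr
    exact norm_imPart_le_of_mem_tube hz) hK
  have h2 := (h f hf _).trans (mul_le_mul_of_nonneg_left (nu_stftAtom_le ψ x z h1) hC)
  have h3 : (1 + 2 * Real.pi * ‖z‖) ^ k ≤ (2 * Real.pi) ^ k * (1 + ‖z‖) ^ k := by
    rw [← mul_pow]
    refine pow_le_pow_left₀ (by positivity) ?_ k
    nlinarith [Real.pi_gt_three]
  have h0 : 0 ≤ nu n K ψ := apply_nonneg _ _
  have h4 : ‖stft ψ f x z‖ ≤ C * (2 ^ k * (2 * Real.pi) ^ k * ((n + 1) ^ K * nu n K ψ)) *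
      ((1 + ‖z‖) ^ k * Real.exp (k * ‖x‖ + 2 * Real.pi * inner ℝ x (imPart z))) := by
    refine h2.trans ?_
    calc _ ≤ C * (2 ^ k * ((2 * Real.pi) ^ k * (1 + ‖z‖) ^ k) * ((n + 1) ^ K * nu n K ψ) *
          Real.exp (k * ‖x‖ + 2 * Real.pi * inner ℝ x (imPart z))) := by gcongr
      _ = _ := by ring
  have h5 : -(k * ‖x‖) - 2 * Real.pi * inner ℝ x (imPart z) =
      -(k * ‖x‖ + 2 * Real.pi * inner ℝ x (imPart z)) := by ring
  rw [h5, Real.exp_neg, ← mul_inv, inv_mul_le_iff₀ (by positivity)]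
  linarith

/-! ### Embedding into bounded functions, and integrals under functionals -/

lemma coe_add (φ χ : KOne n) : ⇑(φ + χ) = ⇑φ + ⇑χ := rfl

lemma coe_sub (φ χ : KOne n) : ⇑(φ - χ) = ⇑φ - ⇑χ := rfl

lemma coe_smul (c : ℂ) (φ : KOne n) : ⇑(c • φ) = c • ⇑φ := rfl

lemma partialDeriv_add {m : ℕ} (j : Fin m → Fin n) (φ χ : KOne n)
    (t : EuclideanSpace ℝ (Fin n)) :
    partialDeriv j (φ + χ : KOne n) t = partialDeriv j φ t + partialDeriv j χ t := by
  unfold partialDeriv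
  rw [coe_add, iteratedFDeriv_add_apply (φ.2.1.contDiffAt.of_le (by exact_mod_cast le_top))
    (χ.2.1.contDiffAt.of_le (by exact_mod_cast le_top))]
  rfl

lemma partialDeriv_smul {m : ℕ} (j : Fin m → Fin n) (c : ℂ) (φ : KOne n)
    (t : EuclideanSpace ℝ (Fin n)) :
    partialDeriv j (c • φ : KOne n) t = c * partialDeriv j φ t := by
  unfold partialDeriv
  rw [coe_smul, iteratedFDeriv_const_smul_apply
    (φ.2.1.contDiffAt.of_le (by exact_mod_cast le_top))]
  rfl

/-- The linear map from `K₁(ℝⁿ)` to a space of bounded functions that turns `ν_k` into the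
supremum norm. -/
def toBounded (n k : ℕ) : KOne n →ₗ[ℂ] lp (fun _ : NuIndex n k => ℂ) ⊤ where
  toFun φ := ⟨fun p => (Real.exp (k * ‖p.1‖) : ℂ) * partialDeriv p.2.2 φ p.1, by
    refine memℓp_infty ⟨nu n k φ, ?_⟩
    rintro _ ⟨p, rfl⟩
    have := nuTerm_le_nu φ p
    simpa [nuTerm, norm_mul, Complex.norm_exp] using this⟩
  map_add' φ χ := by
    ext p
    simp [partialDeriv_add, mul_add]
    rfl
  map_smul' c φ := by
    ext p
    simp [partialDeriv_smul, mul_left_comm]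

lemma toBounded_apply (k : ℕ) (φ : KOne n) (p : NuIndex n k) :
    toBounded n k φ p = (Real.exp (k * ‖p.1‖) : ℂ) * partialDeriv p.2.2 φ p.1 := rfl

lemma norm_toBounded (k : ℕ) (φ : KOne n) : ‖toBounded n k φ‖ = nu n k φ := by
  rw [lp.norm_eq_ciSup]
  refine congrArg iSup (funext fun p => ?_)
  rw [toBounded_apply, norm_mul, Complex.norm_real, Real.norm_eq_abs, Real.abs_exp]
  rfl

lemma toBounded_injective (n k : ℕ) : Function.Injective (toBounded n k) := by
  intro φ χ h
  refine Subtype.ext (funext fun t => ?_)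
  have := congrArg (fun F : lp (fun _ : NuIndex n k => ℂ) ⊤ => F (t, ⟨0, Fin.elim0⟩)) h
  have h2 : partialDeriv Fin.elim0 φ t = partialDeriv Fin.elim0 χ t :=
    mul_left_cancel₀ (Complex.ofReal_ne_zero.2 (Real.exp_ne_zero (k * ‖t‖))) this
  simpa only [partialDeriv, iteratedFDeriv_zero_apply] using h2

lemma continuous_of_norm_sub_le {G : Type*} [SeminormedAddCommGroup G] {F : KOne n → G} {k : ℕ}
    {C : ℝ} (h : ∀ φ χ, ‖F φ - F χ‖ ≤ C * nu n k (φ - χ)) : Continuous F := by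
  refine continuous_iff_continuousAt.2 fun χ => tendsto_iff_norm_sub_tendsto_zero.2 ?_
  have hc : Continuous fun φ => C * nu n k (φ - χ) :=
    continuous_const.mul (((withSeminorms_nu n).continuous_seminorm k).comp
      (continuous_id.sub continuous_const))
  refine squeeze_zero (fun _ => norm_nonneg _) (fun φ => h φ χ) ?_
  simpa using hc.tendsto χ

lemma continuous_toBounded (n k : ℕ) : Continuous (toBounded n k) :=
  continuous_of_norm_sub_le (k := k) (C := 1) fun φ χ => by
    rw [← map_sub, norm_toBounded, one_mul]

lemma iteratedFDeriv_coe_sub (m : ℕ) (φ χ : KOne n) (t : EuclideanSpace ℝ (Fin n)) :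
    iteratedFDeriv ℝ m (φ - χ : KOne n) t = iteratedFDeriv ℝ m φ t - iteratedFDeriv ℝ m χ t := by
  rw [coe_sub, iteratedFDeriv_sub_apply (φ.2.1.contDiffAt.of_le (by exact_mod_cast le_top))
    (χ.2.1.contDiffAt.of_le (by exact_mod_cast le_top))]

lemma norm_iteratedFDeriv_le_mul_nu (m : ℕ) (φ : KOne n) (t : EuclideanSpace ℝ (Fin n)) :
    ‖iteratedFDeriv ℝ m φ t‖ ≤ (n + 1) ^ m * nu n m φ := by
  have h0 : 0 ≤ nu n m φ := apply_nonneg _ _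
  refine (norm_iteratedFDeriv_le_nu le_rfl φ t).trans ?_
  refine mul_le_of_le_one_right (by positivity) (Real.exp_le_one_iff.2 ?_)
  simp only [Left.neg_nonpos_iff]
  positivity

lemma continuous_iteratedFDeriv_apply (m : ℕ) (t : EuclideanSpace ℝ (Fin n)) :
    Continuous fun φ : KOne n => iteratedFDeriv ℝ m φ t := by
  refine continuous_of_norm_sub_le (k := m) (C := (n + 1) ^ m) fun φ χ => ?_
  rw [← iteratedFDeriv_coe_sub]
  exact norm_iteratedFDeriv_le_mul_nu m (φ - χ) t

section Integral

variable {P : Type*} [TopologicalSpace P] [MeasurableSpace P] [OpensMeasurableSpace P]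
  [SecondCountableTopology P] {μ : Measure P} {a : P → KOne n}

lemma integrable_of_nu_le {G : Type*} [NormedAddCommGroup G] {F : KOne n → G}
    (hF : Continuous F) {k : ℕ} {C : ℝ} (hFk : ∀ φ, ‖F φ‖ ≤ C * nu n k φ) (ha : Continuous a)
    (hb : ∀ k, ∃ g : P → ℝ, Integrable g μ ∧ ∀ p, nu n k (a p) ≤ g p) :
    Integrable (fun p => F (a p)) μ := by
  obtain ⟨g, hg, hag⟩ := hb k
  refine (hg.const_mul |C|).mono' (hF.comp ha).aestronglyMeasurable (ae_of_all _ fun p => ?_)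
  exact (hFk _).trans (mul_le_mul (le_abs_self C) (hag p) (apply_nonneg _ _) (abs_nonneg C))

lemma integrable_iteratedFDeriv (ha : Continuous a)
    (hb : ∀ k, ∃ g : P → ℝ, Integrable g μ ∧ ∀ p, nu n k (a p) ≤ g p) (m : ℕ)
    (t : EuclideanSpace ℝ (Fin n)) : Integrable (fun p => iteratedFDeriv ℝ m (a p) t) μ :=
  integrable_of_nu_le (continuous_iteratedFDeriv_apply m t)
    (fun φ => norm_iteratedFDeriv_le_mul_nu m φ t) ha hb

set_option synthInstance.maxHeartbeats 200000 in
/-- Differentiation under the integral sign. -/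
lemma iteratedFDeriv_eq_integral (ha : Continuous a)
    (hb : ∀ k, ∃ g : P → ℝ, Integrable g μ ∧ ∀ p, nu n k (a p) ≤ g p) {φ : KOne n}
    (hφ : ∀ t, ∫ p, a p t ∂μ = φ t) (m : ℕ) (t : EuclideanSpace ℝ (Fin n)) :
    iteratedFDeriv ℝ m φ t = ∫ p, iteratedFDeriv ℝ m (a p) t ∂μ := by
  induction m generalizing t with
  | zero =>
    have := (continuousMultilinearCurryFin0 ℝ
      (EuclideanSpace ℝ (Fin n)) ℂ).symm.toContinuousLinearEquiv.integral_comp_comm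
      (μ := μ) (fun p => a p t)
    simp only [iteratedFDeriv_zero_eq_comp, Function.comp_apply]
    rw [← hφ t]
    exact this.symm
  | succ m ih =>
    let I : (EuclideanSpace ℝ (Fin n) [×m + 1]→L[ℝ] ℂ) ≃ₗᵢ[ℝ]
        (EuclideanSpace ℝ (Fin n) →L[ℝ] EuclideanSpace ℝ (Fin n) [×m]→L[ℝ] ℂ) :=
      continuousMultilinearCurryLeftEquiv ℝ (fun _ : Fin (m + 1) => EuclideanSpace ℝ (Fin n)) ℂ
    have hI : ∀ χ : KOne n, ∀ s,
        fderiv ℝ (iteratedFDeriv ℝ m χ) s = I (iteratedFDeriv ℝ (m + 1) χ s) := fun χ s => by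
      rw [iteratedFDeriv_succ_eq_comp_left]
      exact (LinearIsometryEquiv.apply_symm_apply _ _).symm
    obtain ⟨g, hg, hag⟩ := hb (m + 1)
    have hd : HasFDerivAt (fun s => ∫ p, iteratedFDeriv ℝ m (a p) s ∂μ)
        (∫ p, fderiv ℝ (iteratedFDeriv ℝ m (a p)) t ∂μ) t := by
      -- The norm ν_{m+1} bounds the next derivative at every point at once, so the domination holds
      -- on the whole space.
      refine hasFDerivAt_integral_of_dominated_of_fderiv_le (s := Set.univ) (𝕜 := ℝ)
        (F' := fun s p => fderiv ℝ (iteratedFDeriv ℝ m (a p)) s)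
        (bound := fun p => (n + 1) ^ (m + 1) * g p) univ_mem
        (Eventually.of_forall fun s => (integrable_iteratedFDeriv ha hb m s).1)
        (integrable_iteratedFDeriv ha hb m t) ?_ (ae_of_all _ fun p s _ => ?_)
        (hg.const_mul _) (ae_of_all _ fun p s _ => ?_)
      · simp only [hI]
        exact I.continuous.comp_aestronglyMeasurable (integrable_iteratedFDeriv ha hb (m + 1) t).1
      · rw [hI, LinearIsometryEquiv.norm_map]
        refine (norm_iteratedFDeriv_le_mul_nu (m + 1) (a p) s).trans ?_
        gcongr
        exact hag p
      · exact (((a p).2.1.differentiable_iteratedFDeriv (m := m)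
          (by exact_mod_cast ENat.natCast_lt_top m)) s).hasFDerivAt
    have hfun : iteratedFDeriv ℝ m φ = fun s => ∫ p, iteratedFDeriv ℝ m (a p) s ∂μ :=
      funext ih
    have h1 := hI φ t
    rw [hfun, hd.fderiv] at h1
    simp only [hI] at h1
    have h2 : ∫ p, I (iteratedFDeriv ℝ (m + 1) (a p) t) ∂μ =
        I (∫ p, iteratedFDeriv ℝ (m + 1) (a p) t ∂μ) := by
      let L : (EuclideanSpace ℝ (Fin n) [×m + 1]→L[ℝ] ℂ) →L[ℝ]
        (EuclideanSpace ℝ (Fin n) →L[ℝ] EuclideanSpace ℝ (Fin n) [×m]→L[ℝ] ℂ) :=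
        I.toContinuousLinearEquiv.toContinuousLinearMap
      exact ContinuousLinearMap.integral_comp_comm (𝕜 := ℝ)
        (E := EuclideanSpace ℝ (Fin n) [×m + 1]→L[ℝ] ℂ)
        (Fₗ := EuclideanSpace ℝ (Fin n) →L[ℝ] EuclideanSpace ℝ (Fin n) [×m]→L[ℝ] ℂ) L
        (integrable_iteratedFDeriv ha hb (m + 1) t)
    exact I.injective (h1.symm.trans h2)

/-- A continuous functional commutes with an absolutely convergent integral in `K₁(ℝⁿ)` that is
known to represent an element of `K₁(ℝⁿ)` pointwise. -/
theorem dual_apply_eq_integral (ha : Continuous a)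
    (hb : ∀ k, ∃ g : P → ℝ, Integrable g μ ∧ ∀ p, nu n k (a p) ≤ g p) {φ : KOne n}
    (hφ : ∀ t, ∫ p, a p t ∂μ = φ t) (f : KOneDual n) : f φ = ∫ p, f (a p) ∂μ := by
  obtain ⟨k, C, hC, hf⟩ := exists_dual_bound f
  -- f is transported to the range of `toBounded n k`, where it is bounded by C, and then extended
  -- by Hahn–Banach.
  let e := LinearEquiv.ofInjective (toBounded n k) (toBounded_injective n k)
  let f₀ : StrongDual ℂ (toBounded n k).range :=
    (f.toLinearMap ∘ₗ e.symm.toLinearMap).mkContinuous C (by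
      intro y
      obtain ⟨χ, rfl⟩ := e.surjective y
      have : ‖e χ‖ = nu n k χ := norm_toBounded k χ
      rw [this]
      simpa using hf χ)
  obtain ⟨F, hF, -⟩ := exists_extension_norm_eq _ f₀
  have hFf : ∀ χ, F (toBounded n k χ) = f χ := fun χ => by
    have := hF (e χ)
    rw [show ((e χ : (toBounded n k).range) : lp (fun _ : NuIndex n k => ℂ) ⊤) =
      toBounded n k χ from rfl] at this
    rw [this]
    simp [f₀]
  have hint : Integrable (fun p => toBounded n k (a p)) μ :=
    integrable_of_nu_le (continuous_toBounded n k) (k := k) (C := 1)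
      (fun χ => by rw [norm_toBounded, one_mul]) ha hb
  -- Compared coordinate by coordinate; each coordinate is an instance of differentiation under the
  -- integral sign.
  have hJ : ∫ p, toBounded n k (a p) ∂μ = toBounded n k φ := by
    ext q
    have h1 := (lp.evalCLM ℂ (fun _ : NuIndex n k => ℂ) ⊤ q).integral_comp_comm hint
    have h2 := (ContinuousMultilinearMap.apply ℝ
      (fun _ : Fin (q.2.1 : ℕ) => EuclideanSpace ℝ (Fin n)) ℂ
      (fun i => EuclideanSpace.single (q.2.2 i) (1 : ℝ))).integral_comp_comm
      (integrable_iteratedFDeriv ha hb q.2.1 q.1)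
    rw [← iteratedFDeriv_eq_integral ha hb hφ] at h2
    refine h1.symm.trans ?_
    change ∫ p, (Real.exp (k * ‖q.1‖) : ℂ) * partialDeriv q.2.2 (a p) q.1 ∂μ = _
    rw [integral_const_mul]
    exact congrArg _ h2
  rw [← hFf φ, ← hJ, ← F.integral_comp_comm hint]
  simp only [hFf]

end Integral

/-! ### Continuity of families in the topology of the norms -/

section Continuity

variable {P : Type*} [NormedAddCommGroup P] [NormedSpace ℝ P]

lemma contDiff_uncurry_iteratedFDeriv {a : P → EuclideanSpace ℝ (Fin n) → ℂ}
    (ha : ContDiff ℝ ∞ (Function.uncurry a)) (m : ℕ) :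
    ContDiff ℝ ∞ (Function.uncurry fun p t => iteratedFDeriv ℝ m (a p) t) := by
  induction m with
  | zero =>
    exact (continuousMultilinearCurryFin0 ℝ (EuclideanSpace ℝ (Fin n)) ℂ).symm.contDiff.comp ha
  | succ m ih =>
    have h : ContDiff ℝ ∞ fun q : P × EuclideanSpace ℝ (Fin n) =>
        fderiv ℝ (iteratedFDeriv ℝ m (a q.1)) q.2 := by
      refine ContDiff.fderiv (m := ∞) (f := fun q : P × EuclideanSpace ℝ (Fin n) =>
        iteratedFDeriv ℝ m (a q.1)) ?_ contDiff_snd (by simp)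
      exact ih.comp ((contDiff_fst.comp contDiff_fst).prodMk contDiff_snd)
    have h2 := (continuousMultilinearCurryLeftEquiv ℝ
      (fun _ : Fin (m + 1) => EuclideanSpace ℝ (Fin n)) ℂ).symm.contDiff.comp h
    convert h2 using 1
    funext q
    rw [Function.uncurry, iteratedFDeriv_succ_eq_comp_left]
    rfl

/-- A jointly smooth, locally bounded family in `K₁(ℝⁿ)` is continuous. -/
lemma continuous_of_contDiff {a : P → KOne n}
    (ha : ContDiff ℝ ∞ (Function.uncurry fun p => ⇑(a p)))
    (hb : ∀ k p₀, ∃ C, ∀ᶠ p in 𝓝 p₀, nu n k (a p) ≤ C) : Continuous a := by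
  refine continuous_iff_continuousAt.2 fun p₀ => ?_
  rw [ContinuousAt, (withSeminorms_nu n).tendsto_nhds]
  intro k ε hε
  -- The extra order yields a factor e^{-|t|}, which makes the difference small outside a ball of
  -- radius R. On the ball, joint continuity and compactness suffice.
  obtain ⟨C, hC⟩ := hb (k + 1) p₀
  have hlim : Tendsto (fun R : ℝ => (n + 1) ^ (k + 1) * (C + C) * Real.exp (-R)) atTop (𝓝 0) := by
    simpa using Real.tendsto_exp_neg_atTop_nhds_zero.const_mul ((n + 1 : ℝ) ^ (k + 1) * (C + C))
  obtain ⟨R, hR⟩ := (hlim.eventually (gt_mem_nhds (half_pos hε))).exists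
  have hunif : ∀ m ∈ Finset.range (k + 1), ∀ᶠ p in 𝓝 p₀,
      ∀ t ∈ Metric.closedBall (0 : EuclideanSpace ℝ (Fin n)) R,
        Real.exp (k * ‖t‖) * ‖iteratedFDeriv ℝ m (a p - a p₀ : KOne n) t‖ < ε / 2 := by
    intro m _
    have hcont : Continuous (Function.uncurry fun (p : P) (t : EuclideanSpace ℝ (Fin n)) =>
        Real.exp (k * ‖t‖) • iteratedFDeriv ℝ m (a p) t) :=
      (by fun_prop : Continuous fun q : P × EuclideanSpace ℝ (Fin n) =>
        Real.exp (k * ‖q.2‖)).smul (contDiff_uncurry_iteratedFDeriv ha m).continuous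
    obtain ⟨v, hv, h⟩ := (isCompact_closedBall (0 : EuclideanSpace ℝ (Fin n)) R).mem_uniformity_of_prod
      (s := Set.univ) hcont.continuousOn (Set.mem_univ p₀) (Metric.dist_mem_uniformity (half_pos hε))
    rw [nhdsWithin_univ] at hv
    filter_upwards [hv] with p hp t ht
    have := h p hp t ht
    simp only [Set.mem_ofPred_eq] at this
    rwa [dist_eq_norm, ← smul_sub, norm_smul, Real.norm_eq_abs, Real.abs_exp,
      ← iteratedFDeriv_coe_sub] at this
  filter_upwards [(Filter.eventually_all_finset _).2 hunif, hC] with p hp hpC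
  refine lt_of_le_of_lt (nu_le (C := ε / 2) fun m hm t => ?_) (half_lt_self hε)
  rcases le_or_gt ‖t‖ R with ht | ht
  · exact (hp m (Finset.mem_range.2 (by omega)) t (by simpa using ht)).le
  · have h1 : nu n (k + 1) (a p - a p₀) ≤ C + C :=
      (map_sub_le_add _ _ _).trans (add_le_add hpC hC.self_of_nhds)
    have h2 := norm_iteratedFDeriv_le_nu (hm.trans (Nat.le_succ k)) (a p - a p₀) t
    have h0 : 0 ≤ nu n (k + 1) (a p - a p₀) := apply_nonneg _ _
    calc _ ≤ Real.exp (k * ‖t‖) * _ := mul_le_mul_of_nonneg_left h2 (Real.exp_pos _).le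
      _ = (n + 1) ^ (k + 1) * nu n (k + 1) (a p - a p₀) * Real.exp (-‖t‖) := by
          rw [mul_left_comm, ← Real.exp_add]
          congr 2
          push_cast
          ring
      _ ≤ (n + 1) ^ (k + 1) * (C + C) * Real.exp (-R) := by
          have := h0.trans h1
          gcongr
      _ ≤ ε / 2 := hR.le

end Continuity

/-! ### Integrable weights and decay of the Fourier transform -/

lemma integrable_exp_neg_norm (n : ℕ) :
    Integrable fun x : EuclideanSpace ℝ (Fin n) => Real.exp (-((n + 1 : ℕ) * ‖x‖)) := by
  have h : Integrable fun x : EuclideanSpace ℝ (Fin n) => (1 + ‖x‖) ^ (-((n + 1 : ℕ) : ℝ)) :=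
    integrable_one_add_norm (by simp)
  refine h.mono' (by fun_prop) (ae_of_all _ fun x => ?_)
  rw [Real.norm_eq_abs, Real.abs_exp, Real.rpow_neg (by positivity), Real.rpow_natCast,
    Real.exp_neg, Real.exp_nat_mul]
  gcongr
  linarith [Real.add_one_le_exp ‖x‖]

lemma integrable_one_add_norm_pow_inv (n : ℕ) :
    Integrable fun x : EuclideanSpace ℝ (Fin n) => ((1 + ‖x‖) ^ (n + 1))⁻¹ := by
  have h : Integrable fun x : EuclideanSpace ℝ (Fin n) => (1 + ‖x‖) ^ (-((n + 1 : ℕ) : ℝ)) :=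
    integrable_one_add_norm (by simp)
  refine h.congr (ae_of_all _ fun x => ?_)
  simp only
  rw [Real.rpow_neg (by positivity), Real.rpow_natCast]

lemma norm_iteratedFDeriv_le_exp {m k : ℕ} (hm : m ≤ k) (φ : KOne n)
    (t : EuclideanSpace ℝ (Fin n)) :
    ‖iteratedFDeriv ℝ m φ t‖ ≤ (n + 1) ^ (k + (n + 1)) * nu n (k + (n + 1)) φ *
      Real.exp (-((n + 1 : ℕ) * ‖t‖)) := by
  have h0 : 0 ≤ nu n (k + (n + 1)) φ := apply_nonneg _ _
  refine (norm_iteratedFDeriv_le_nu (k := k + (n + 1)) (by omega) φ t).trans ?_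
  have h1 : ((n + 1 : ℕ) : ℝ) ≤ (k + (n + 1) : ℕ) := by exact_mod_cast Nat.le_add_left _ _
  exact mul_le_mul_of_nonneg_left (Real.exp_le_exp.2 (neg_le_neg
    (mul_le_mul_of_nonneg_right h1 (norm_nonneg t)))) (by positivity)

lemma integrable_norm_iteratedFDeriv (m : ℕ) (φ : KOne n) :
    Integrable fun t => ‖iteratedFDeriv ℝ m φ t‖ := by
  refine ((integrable_exp_neg_norm n).const_mul
    ((n + 1) ^ (m + (n + 1)) * nu n (m + (n + 1)) φ)).mono'
    (φ.2.1.continuous_iteratedFDeriv (m := m)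
      (by exact_mod_cast le_top)).norm.aestronglyMeasurable (ae_of_all _ fun t => ?_)
  rw [norm_norm]
  exact norm_iteratedFDeriv_le_exp le_rfl φ t

lemma integrable_coe (φ : KOne n) : Integrable φ := by
  refine (integrable_norm_iff φ.2.1.continuous.aestronglyMeasurable).1 ?_
  simpa using integrable_norm_iteratedFDeriv 0 φ

lemma integral_norm_iteratedFDeriv_le {m k : ℕ} (hm : m ≤ k) (φ : KOne n) :
    ∫ t, ‖iteratedFDeriv ℝ m φ t‖ ≤ (n + 1) ^ (k + (n + 1)) * nu n (k + (n + 1)) φ *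
      ∫ t : EuclideanSpace ℝ (Fin n), Real.exp (-((n + 1 : ℕ) * ‖t‖)) := by
  rw [← integral_const_mul]
  exact integral_mono (integrable_norm_iteratedFDeriv m φ)
    ((integrable_exp_neg_norm n).const_mul _) fun t => norm_iteratedFDeriv_le_exp hm φ t

lemma pow_mul_norm_fourier_le {m k : ℕ} (hm : m ≤ k) (φ : KOne n)
    (w : EuclideanSpace ℝ (Fin n)) :
    ‖w‖ ^ m * ‖𝓕 (φ : EuclideanSpace ℝ (Fin n) → ℂ) w‖ ≤
      2 ^ k * ((k + 1) * ((n + 1) ^ (k + (n + 1)) * nu n (k + (n + 1)) φ *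
        ∫ t : EuclideanSpace ℝ (Fin n), Real.exp (-((n + 1 : ℕ) * ‖t‖)))) := by
  have hJ : 0 ≤ ∫ t : EuclideanSpace ℝ (Fin n), Real.exp (-((n + 1 : ℕ) * ‖t‖)) :=
    integral_nonneg fun t => (Real.exp_pos _).le
  have h0 : 0 ≤ nu n (k + (n + 1)) φ := apply_nonneg _ _
  -- The transform itself is not differentiated, so no moments are needed: K = 0.
  have h := Real.pow_mul_norm_iteratedFDeriv_fourier_le (f := φ) (K := 0) (N := ⊤) φ.2.1
    (fun i j hi _ => by
      have : i = 0 := by simpa using hi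
      subst this
      simpa using integrable_norm_iteratedFDeriv j φ) (k := 0) (n := m) (by simp) le_top w
  simp only [norm_iteratedFDeriv_zero, pow_zero, one_mul, Nat.cast_zero, mul_zero, zero_add] at h
  refine h.trans ?_
  rw [Finset.sum_product]
  simp only [Finset.range_one, Finset.sum_singleton, pow_zero, one_mul]
  refine mul_le_mul (pow_le_pow_right₀ (by norm_num) hm) ?_
    (Finset.sum_nonneg fun i _ => integral_nonneg fun t => norm_nonneg _) (by positivity)
  refine (Finset.sum_le_sum fun i hi => integral_norm_iteratedFDeriv_le (k := k)
    (by simp at hi; omega) φ).trans ?_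
  rw [Finset.sum_const, Finset.card_range, nsmul_eq_mul]
  gcongr
  push_cast
  gcongr

/-- The Fourier transform of an element of `K₁(ℝⁿ)` decreases rapidly. -/
lemma exists_fourier_decay (n k : ℕ) : ∃ (C : ℝ) (K : ℕ), 0 ≤ C ∧ ∀ (φ : KOne n) w,
    ‖𝓕 (φ : EuclideanSpace ℝ (Fin n) → ℂ) w‖ * (1 + ‖w‖) ^ k ≤
      C * nu n K φ * ((1 + ‖w‖) ^ (n + 1))⁻¹ := by
  -- Power k is the decay asked for; the other n + 1 powers leave an integrable weight.
  let m := k + (n + 1)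
  let J := ∫ t : EuclideanSpace ℝ (Fin n), Real.exp (-((n + 1 : ℕ) * ‖t‖))
  have hJ : 0 ≤ J := integral_nonneg fun t => (Real.exp_pos _).le
  refine ⟨2 ^ m * (2 * (2 ^ m * ((m + 1) * ((n + 1) ^ (m + (n + 1)) * J)))), m + (n + 1),
    by positivity, fun φ w => ?_⟩
  have h1 := pow_mul_norm_fourier_le (Nat.zero_le m) φ w
  have h2 := pow_mul_norm_fourier_le (le_refl m) φ w
  rw [pow_zero, one_mul] at h1
  have h3 : (1 + ‖w‖) ^ m ≤ 2 ^ m * (1 + ‖w‖ ^ m) := by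
    have := add_pow_le (zero_le_one' ℝ) (norm_nonneg w) m
    rw [one_pow] at this
    refine this.trans ?_
    gcongr
    · norm_num
    · exact Nat.sub_le _ _
  rw [← div_eq_mul_inv, le_div_iff₀ (by positivity), mul_assoc, ← pow_add]
  calc _ ≤ ‖𝓕 (φ : EuclideanSpace ℝ (Fin n) → ℂ) w‖ * (2 ^ m * (1 + ‖w‖ ^ m)) := by gcongr
    _ = 2 ^ m * (‖𝓕 (φ : EuclideanSpace ℝ (Fin n) → ℂ) w‖ +
        ‖w‖ ^ m * ‖𝓕 (φ : EuclideanSpace ℝ (Fin n) → ℂ) w‖) := by ring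
    _ ≤ 2 ^ m * (_ + _) := mul_le_mul_of_nonneg_left (add_le_add h1 h2) (by positivity)
    _ = _ := by ring

lemma continuous_fourier (φ : KOne n) : Continuous (𝓕 (φ : EuclideanSpace ℝ (Fin n) → ℂ)) :=
  VectorFourier.fourierIntegral_continuous Real.continuous_fourierChar
    (by exact continuous_inner) (integrable_coe φ)

lemma integrable_fourier (φ : KOne n) : Integrable (𝓕 (φ : EuclideanSpace ℝ (Fin n) → ℂ)) := by
  obtain ⟨C, K, -, h⟩ := exists_fourier_decay n 0
  refine ((integrable_one_add_norm_pow_inv n).const_mul (C * nu n K φ)).mono'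
    (continuous_fourier φ).aestronglyMeasurable (ae_of_all _ fun w => ?_)
  simpa using h φ w

/-! ### Atoms along the slice of imaginary part η -/

lemma imPart_complexPoint (ξ η : EuclideanSpace ℝ (Fin n)) : imPart (complexPoint ξ η) = η := by
  ext j
  simp [imPart, complexPoint]

lemma norm_complexPoint_le (ξ η : EuclideanSpace ℝ (Fin n)) :
    ‖complexPoint ξ η‖ ≤ ‖ξ‖ + ‖η‖ := by
  have h : complexPoint ξ η = (WithLp.toLp 2 fun j => (ξ j : ℂ) : EuclideanSpace ℂ (Fin n)) +
      Complex.I • (WithLp.toLp 2 fun j => (η j : ℂ) : EuclideanSpace ℂ (Fin n)) := by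
    ext j
    simp [complexPoint, mul_comm]
  rw [h]
  refine (norm_add_le _ _).trans (le_of_eq ?_)
  simp [norm_smul, EuclideanSpace.norm_eq]

lemma phase_complexPoint (ξ η t : EuclideanSpace ℝ (Fin n)) :
    phase (complexPoint ξ η) t =
      ((-2 * Real.pi * inner ℝ t ξ : ℝ) : ℂ) * Complex.I + phase (complexPoint 0 η) t := by
  simp only [phase_apply, complexPoint, PiLp.inner_apply]
  simp only [add_mul, Finset.sum_add_distrib, PiLp.zero_apply, Complex.ofReal_zero,
    zero_add, mul_add, RCLike.inner_apply, conj_trivial]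
  push_cast
  congr 1
  ring

lemma exists_nu_stftAtom_le (ψ : KOne n) (x η : EuclideanSpace ℝ (Fin n)) (k : ℕ) :
    ∃ C, 0 ≤ C ∧ ∀ ξ, nu n k (stftAtom ψ x (complexPoint ξ η)) ≤ C * (1 + ‖ξ‖) ^ k := by
  obtain ⟨K, hK⟩ := exists_nat_ge (k + 2 * Real.pi * ‖η‖)
  have h0 : 0 ≤ nu n K ψ := apply_nonneg _ _
  refine ⟨2 ^ k * (2 * Real.pi * (1 + ‖η‖)) ^ k * ((n + 1) ^ K * nu n K ψ) *
    Real.exp (k * ‖x‖ + 2 * Real.pi * inner ℝ x η), by positivity, fun ξ => ?_⟩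
  refine (nu_stftAtom_le ψ x (complexPoint ξ η) (by rwa [imPart_complexPoint])).trans ?_
  rw [imPart_complexPoint]
  have h1 : 1 + 2 * Real.pi * ‖complexPoint ξ η‖ ≤ 2 * Real.pi * (1 + ‖η‖) * (1 + ‖ξ‖) := by
    calc _ ≤ 2 * Real.pi * 1 + 2 * Real.pi * (‖ξ‖ + ‖η‖) := by
          gcongr
          · linarith [Real.pi_gt_three]
          · exact norm_complexPoint_le ξ η
      _ ≤ 2 * Real.pi * 1 + 2 * Real.pi * (‖ξ‖ + ‖η‖) + 2 * Real.pi * (‖ξ‖ * ‖η‖) :=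
          le_add_of_nonneg_right (by positivity)
      _ = _ := by ring
  calc _ ≤ 2 ^ k * (2 * Real.pi * (1 + ‖η‖) * (1 + ‖ξ‖)) ^ k * ((n + 1) ^ K * nu n K ψ) *
        Real.exp (k * ‖x‖ + 2 * Real.pi * inner ℝ x η) := by gcongr
    _ = _ := by rw [mul_pow]; ring

lemma continuous_stftAtom (ψ : KOne n) (x η : EuclideanSpace ℝ (Fin n)) :
    Continuous fun ξ => stftAtom ψ x (complexPoint ξ η) := by
  refine continuous_of_contDiff ?_ fun k ξ₀ => ?_
  · have h : (Function.uncurry fun ξ => ⇑(stftAtom ψ x (complexPoint ξ η))) =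
        fun q : EuclideanSpace ℝ (Fin n) × EuclideanSpace ℝ (Fin n) =>
          Complex.exp (Complex.ofRealCLM (-2 * Real.pi * inner ℝ q.2 q.1) * Complex.I +
            phase (complexPoint 0 η) q.2) * Complex.conjLIE (ψ (q.2 - x)) := by
      funext q
      rw [Function.uncurry, stftAtom_apply, phase_complexPoint]
      rfl
    rw [h]
    refine ContDiff.mul (ContDiff.cexp (ContDiff.add (ContDiff.mul
      (Complex.ofRealCLM.contDiff.comp ?_) contDiff_const)
      ((phase (complexPoint 0 η)).contDiff.comp contDiff_snd)))
      (Complex.conjLIE.contDiff.comp (ψ.2.1.comp (contDiff_snd.sub contDiff_const)))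
    exact contDiff_const.mul (contDiff_snd.inner ℝ contDiff_fst)
  · obtain ⟨C, -, hC⟩ := exists_nu_stftAtom_le ψ x η k
    have hc : Continuous fun ξ : EuclideanSpace ℝ (Fin n) => C * (1 + ‖ξ‖) ^ k := by fun_prop
    refine ⟨_, ((hc.tendsto ξ₀).eventually (gt_mem_nhds (lt_add_one _))).mono fun ξ hξ =>
      (hC ξ).trans hξ.le⟩

lemma continuous_mulTranslate (φ χ : KOne n) : Continuous (mulTranslate φ χ) := by
  refine continuous_of_contDiff ?_ fun k x₀ => ?_
  · exact (φ.2.1.comp contDiff_snd).mul (χ.2.1.comp (contDiff_snd.sub contDiff_fst))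
  · have h := fun x => nu_mulTranslate_le φ χ x k 0
    simp only [Nat.cast_zero, zero_mul, neg_zero, Real.exp_zero, mul_one] at h
    exact ⟨_, Eventually.of_forall h⟩

/-! ### Reconstruction of f from one slice -/

/-- The function `|ψ|²` as an element of `K₁(ℝⁿ)`. -/
def normSq (ψ : KOne n) : KOne n := mulTranslate ψ (stftAtom ψ 0 0) 0

lemma normSq_apply (ψ : KOne n) (t : EuclideanSpace ℝ (Fin n)) :
    normSq ψ t = ψ t * starRingEnd ℂ (ψ t) := by
  simp [normSq, stftAtom_apply, phase_apply]

lemma integral_normSq_ne_zero {ψ : KOne n} (hψ : ψ ≠ 0) : ∫ t, normSq ψ t ≠ 0 := by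
  obtain ⟨t₀, ht₀⟩ : ∃ t, ψ t ≠ 0 := by
    by_contra! h
    exact hψ (Subtype.ext (funext h))
  have h : ∀ t, normSq ψ t = ((‖ψ t‖ ^ 2 : ℝ) : ℂ) := fun t => by
    rw [normSq_apply, Complex.mul_conj']
    push_cast
    rfl
  have hint : Integrable fun t => ‖ψ t‖ ^ 2 := by
    refine (integrable_coe (normSq ψ)).norm.congr (ae_of_all _ fun t => ?_)
    simp [h]
  have hpos : 0 < ∫ t, ‖ψ t‖ ^ 2 := integral_pos_of_integrable_nonneg_nonzero (x := t₀)
    (ψ.2.1.continuous.norm.pow 2) hint (fun t => by positivity)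
    (pow_ne_zero 2 (norm_ne_zero_iff.2 ht₀))
  simp only [h, integral_complex_ofReal]
  exact_mod_cast hpos.ne'

/-- Up to the factor `∫ χ`, the value `f φ` is recovered from the values of `f` on `φ · χ(· - x)`. -/
lemma integral_mul_dual_apply (f : KOneDual n) (φ χ : KOne n) :
    (∫ t, χ t) * f φ = ∫ x, f (mulTranslate φ χ x) := by
  rw [← smul_eq_mul, ← map_smul]
  refine dual_apply_eq_integral (continuous_mulTranslate φ χ) (fun k => ?_) (fun t => ?_) f
  · exact ⟨_, (integrable_exp_neg_norm n).const_mul _,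
      fun x => nu_mulTranslate_le φ χ x k (n + 1)⟩
  · simp only [mulTranslate_apply]
    rw [integral_const_mul, integral_sub_left_eq_self (fun t => χ t) volume t, mul_comm]
    rfl

/-- The function `t ↦ e^{-2πη·t} φ(t) ψ(t - x)`, whose Fourier transform gives the coefficients in
the reconstruction formula for the short-time Fourier transform on `ℝⁿ × (ℝⁿ + iη)`. -/
def synthesisWindow (η : EuclideanSpace ℝ (Fin n)) (φ ψ : KOne n)
    (x : EuclideanSpace ℝ (Fin n)) : KOne n :=
  mulTranslate (expMul (-phase (complexPoint 0 η)) φ) ψ x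

/-- Fourier inversion at t; the sign in -ξ matches the kernel e^{-2πi ξ·t} of the atom. The atom's
factor e^{2πη·t} cancels the e^{-2πη·t} in the window, leaving φ(t)ψ(t - x) conj ψ(t - x). -/
lemma integral_fourier_mul_stftAtom (η : EuclideanSpace ℝ (Fin n)) (φ ψ : KOne n)
    (x t : EuclideanSpace ℝ (Fin n)) :
    ∫ ξ, 𝓕 (synthesisWindow η φ ψ x : EuclideanSpace ℝ (Fin n) → ℂ) (-ξ) *
      stftAtom ψ x (complexPoint ξ η) t = mulTranslate φ (normSq ψ) x t := by
  let g := synthesisWindow η φ ψ x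
  have h1 : ∫ ξ, Complex.exp (((-2 * Real.pi * inner ℝ t ξ : ℝ) : ℂ) * Complex.I) *
      𝓕 (g : EuclideanSpace ℝ (Fin n) → ℂ) (-ξ) = g t := by
    have h2 := congrFun (g.2.1.continuous.fourierInv_fourier_eq (integrable_coe g)
      (integrable_fourier g)) t
    rw [Real.fourierInv_eq', ← integral_neg_eq_self] at h2
    rw [← h2]
    refine integral_congr_ae (ae_of_all _ fun ξ => ?_)
    simp only [smul_eq_mul, inner_neg_left, real_inner_comm t ξ]
    congr 3
    push_cast
    ring
  have h3 : ∀ ξ, 𝓕 (g : EuclideanSpace ℝ (Fin n) → ℂ) (-ξ) *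
      stftAtom ψ x (complexPoint ξ η) t =
      Complex.exp (((-2 * Real.pi * inner ℝ t ξ : ℝ) : ℂ) * Complex.I) *
      𝓕 (g : EuclideanSpace ℝ (Fin n) → ℂ) (-ξ) *
        (Complex.exp (phase (complexPoint 0 η) t) * starRingEnd ℂ (ψ (t - x))) := fun ξ => by
    rw [stftAtom_apply, phase_complexPoint, Complex.exp_add]
    ring
  change ∫ ξ, 𝓕 (g : EuclideanSpace ℝ (Fin n) → ℂ) (-ξ) * _ = _
  simp only [h3]
  rw [integral_mul_const, h1, mulTranslate_apply, normSq_apply]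
  change Complex.exp (-phase (complexPoint 0 η) t) * φ t * ψ (t - x) * _ = _
  rw [Complex.exp_neg]
  field_simp [Complex.exp_ne_zero]

lemma dual_mulTranslate_normSq (f : KOneDual n) (η : EuclideanSpace ℝ (Fin n)) (φ ψ : KOne n)
    (x : EuclideanSpace ℝ (Fin n)) :
    f (mulTranslate φ (normSq ψ) x) =
      ∫ ξ, 𝓕 (synthesisWindow η φ ψ x : EuclideanSpace ℝ (Fin n) → ℂ) (-ξ) *
        stft ψ f x (complexPoint ξ η) := by
  let g := synthesisWindow η φ ψ x
  have h := dual_apply_eq_integral (μ := volume)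
    (a := fun ξ => 𝓕 (g : EuclideanSpace ℝ (Fin n) → ℂ) (-ξ) • stftAtom ψ x (complexPoint ξ η))
    (φ := mulTranslate φ (normSq ψ) x)
    (((continuous_fourier g).comp continuous_neg).smul (continuous_stftAtom ψ x η))
    (fun k => ?_) (fun t => integral_fourier_mul_stftAtom η φ ψ x t) f
  · rw [h]
    simp only [map_smul, smul_eq_mul]
    rfl
  · obtain ⟨C, hC0, hC⟩ := exists_nu_stftAtom_le ψ x η k
    obtain ⟨D, K, -, hD⟩ := exists_fourier_decay n k
    refine ⟨_, (integrable_one_add_norm_pow_inv n).const_mul (C * (D * nu n K g)), fun ξ => ?_⟩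
    have h2 := hD g (-ξ)
    rw [norm_neg] at h2
    rw [map_smul_eq_mul]
    calc _ ≤ ‖𝓕 (g : EuclideanSpace ℝ (Fin n) → ℂ) (-ξ)‖ * (C * (1 + ‖ξ‖) ^ k) := by
          gcongr
          exact hC ξ
      _ = C * (‖𝓕 (g : EuclideanSpace ℝ (Fin n) → ℂ) (-ξ)‖ * (1 + ‖ξ‖) ^ k) := by ring
      _ ≤ C * (D * nu n K g * ((1 + ‖ξ‖) ^ (n + 1))⁻¹) := by gcongr
      _ = _ := by ring

/-- The rate l is at our disposal because φ and ψ(· - x) both decay faster than any exponential; the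
factor e^{-2πη·t} only raises the order K. -/
lemma exists_nu_synthesisWindow_le (η : EuclideanSpace ℝ (Fin n)) (ψ : KOne n) (k l : ℕ) :
    ∃ (C : ℝ) (K : ℕ), 0 ≤ C ∧ ∀ φ x,
      nu n k (synthesisWindow η φ ψ x) ≤ C * nu n K φ * Real.exp (-(l * ‖x‖)) := by
  let L := -phase (complexPoint 0 η)
  obtain ⟨K, hK⟩ := exists_nat_ge ((k + l : ℕ) + ‖L‖)
  have h0 : 0 ≤ nu n (k + l) ψ := apply_nonneg _ _
  refine ⟨2 ^ (k + l) * ((n + 1) ^ (k + l) * (2 ^ (k + l) * (1 + ‖L‖) ^ (k + l) * (n + 1) ^ K)) *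
    ((n + 1) ^ (k + l) * nu n (k + l) ψ), K, by positivity, fun φ x => ?_⟩
  calc _ ≤ _ := nu_mulTranslate_le (expMul L φ) ψ x k l
    _ ≤ 2 ^ (k + l) * ((n + 1) ^ (k + l) *
        (2 ^ (k + l) * (1 + ‖L‖) ^ (k + l) * ((n + 1) ^ K * nu n K φ))) *
        ((n + 1) ^ (k + l) * nu n (k + l) ψ) * Real.exp (-(l * ‖x‖)) := by
          gcongr
          exact nu_expMul_le L φ hK
    _ = _ := by ring

/-! ### The growth bound implies boundedness -/

theorem isVonNBounded_of_stft_bound {ψ : KOne n} (hψ : ψ ≠ 0) {B : Set (KOneDual n)}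
    {η : EuclideanSpace ℝ (Fin n)} {k : ℕ} {C : ℝ}
    (h : ∀ f ∈ B, ∀ x ξ : EuclideanSpace ℝ (Fin n),
      Real.exp (-(k * ‖x‖)) * ((1 + ‖ξ‖) ^ k)⁻¹ * ‖stft ψ f x (complexPoint ξ η)‖ ≤ C) :
    Bornology.IsVonNBounded ℂ B := by
  -- An element of B is needed to know that C ≥ 0.
  rcases B.eq_empty_or_nonempty with rfl | ⟨f₀, hf₀⟩
  · exact Bornology.isVonNBounded_empty ℂ _
  have hC : 0 ≤ C := le_trans (by positivity) (h f₀ hf₀ 0 0)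
  have hstft : ∀ f ∈ B, ∀ x ξ : EuclideanSpace ℝ (Fin n),
      ‖stft ψ f x (complexPoint ξ η)‖ ≤ C * (Real.exp (k * ‖x‖) * (1 + ‖ξ‖) ^ k) := by
    intro f hf x ξ
    have := h f hf x ξ
    rwa [Real.exp_neg, ← mul_inv, inv_mul_le_iff₀ (by positivity), mul_comm] at this
  obtain ⟨D, K, hD0, hD⟩ := exists_fourier_decay n k
  -- Rate k cancels the growth e^{k|x|} of the transform; the remaining n + 1 makes the integral
  -- over x converge.
  obtain ⟨D', K', hD0', hD'⟩ := exists_nu_synthesisWindow_le η ψ K (k + (n + 1))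
  let c := ∫ t, normSq ψ t
  have hc : 0 < ‖c‖ := norm_pos_iff.2 (integral_normSq_ne_zero hψ)
  let W := ∫ ξ : EuclideanSpace ℝ (Fin n), ((1 + ‖ξ‖) ^ (n + 1))⁻¹
  have hW : 0 ≤ W := integral_nonneg fun ξ => by positivity
  let J := ∫ x : EuclideanSpace ℝ (Fin n), Real.exp (-((n + 1 : ℕ) * ‖x‖))
  have hslice : ∀ f ∈ B, ∀ φ x, ‖f (mulTranslate φ (normSq ψ) x)‖ ≤
      C * D * D' * W * nu n K' φ * Real.exp (-((n + 1 : ℕ) * ‖x‖)) := by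
    intro f hf φ x
    let g := synthesisWindow η φ ψ x
    have h1 : ‖f (mulTranslate φ (normSq ψ) x)‖ ≤
        ∫ ξ : EuclideanSpace ℝ (Fin n),
          C * Real.exp (k * ‖x‖) * (D * nu n K g) * ((1 + ‖ξ‖) ^ (n + 1))⁻¹ := by
      rw [dual_mulTranslate_normSq f η]
      refine norm_integral_le_of_norm_le ((integrable_one_add_norm_pow_inv n).const_mul _)
        (ae_of_all _ fun ξ => ?_)
      have h2 := hD g (-ξ)
      rw [norm_neg] at h2
      rw [norm_mul]
      calc _ ≤ ‖𝓕 (g : EuclideanSpace ℝ (Fin n) → ℂ) (-ξ)‖ *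
            (C * (Real.exp (k * ‖x‖) * (1 + ‖ξ‖) ^ k)) := by
            gcongr
            exact hstft f hf x ξ
        _ = C * Real.exp (k * ‖x‖) *
            (‖𝓕 (g : EuclideanSpace ℝ (Fin n) → ℂ) (-ξ)‖ * (1 + ‖ξ‖) ^ k) := by ring
        _ ≤ C * Real.exp (k * ‖x‖) * (D * nu n K g * ((1 + ‖ξ‖) ^ (n + 1))⁻¹) := by gcongr
        _ = _ := by ring
    rw [integral_const_mul] at h1
    have h3 : Real.exp (k * ‖x‖) * Real.exp (-((k + (n + 1) : ℕ) * ‖x‖)) =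
        Real.exp (-((n + 1 : ℕ) * ‖x‖)) := by
      rw [← Real.exp_add]
      congr 1
      push_cast
      ring
    calc _ ≤ C * Real.exp (k * ‖x‖) * (D * nu n K g) * W := h1
      _ ≤ C * Real.exp (k * ‖x‖) *
          (D * (D' * nu n K' φ * Real.exp (-((k + (n + 1) : ℕ) * ‖x‖)))) * W := by
          gcongr
          exact hD' φ x
      _ = C * D * D' * W * nu n K' φ *
          (Real.exp (k * ‖x‖) * Real.exp (-((k + (n + 1) : ℕ) * ‖x‖))) := by ring
      _ = _ := by rw [h3]
  refine isVonNBounded_of_le_nu (k := K') (C := C * D * D' * W * J / ‖c‖) fun f hf φ => ?_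
  have h1 : ‖c‖ * ‖f φ‖ ≤ C * D * D' * W * nu n K' φ * J := by
    rw [← norm_mul, integral_mul_dual_apply f φ (normSq ψ), ← integral_const_mul]
    exact norm_integral_le_of_norm_le ((integrable_exp_neg_norm n).const_mul _)
      (ae_of_all _ fun x => hslice f hf φ x)
  rw [div_mul_eq_mul_div, le_div_iff₀ hc]
  linarith

end ExpType

end

theorem mainTheorem8 (n : ℕ) (B : Set (ExpType.KOneDual n)) (ψ : ExpType.KOne n) (hψ : ψ ≠ 0) :
    ((∃ (η : EuclideanSpace ℝ (Fin n)) (k : ℕ) (C : ℝ),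
        ∀ f ∈ B, ∀ x ξ : EuclideanSpace ℝ (Fin n),
          Real.exp (-(k * ‖x‖)) * ((1 + ‖ξ‖) ^ k)⁻¹ * ‖ExpType.stft ψ f x (ExpType.complexPoint ξ η)‖ ≤ C) →
      Bornology.IsVonNBounded ℂ B) ∧
    (Bornology.IsVonNBounded ℂ B →
      ∃ k : ℕ, ∀ r : ℝ, 0 ≤ r → ∃ C : ℝ,
        ∀ f ∈ B, ∀ x : EuclideanSpace ℝ (Fin n), ∀ z ∈ ExpType.tube n r,
          Real.exp (-(k * ‖x‖) - 2 * Real.pi * inner ℝ x (ExpType.imPart z)) * ((1 + ‖z‖) ^ k)⁻¹ *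
            ‖ExpType.stft ψ f x z‖ ≤ C) :=
  ⟨fun ⟨_, _, _, h⟩ => ExpType.isVonNBounded_of_stft_bound hψ h,
    ExpType.stft_bound_of_isVonNBounded ψ⟩
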